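/- Let $E\to M$ be a smooth real vector bundle of finite rank $n$ over a smooth finite-dimensional manifold $M$ (Hausdorff, without boundary). Suppose that $E$ carries a Lie algebroid structure, i.e. a smooth vector bundle morphism $\rho:E\to TM$ over the identity (the anchor) and a real Lie bracket $[\cdot,\cdot]$ on the space $\Gamma(E)$ of smooth sections such that $[u,fv]=f[u,v]+\rho(u)[f]\,v$ for all $u,v\in\Gamma(E)$ and $f\in C^\infty(M)$. Let $G=\langle\cdot|\cdot\rangle$ be a Riemannian metric on $E$, i.e. a smooth family of inner products on the fibres, and regard $G$ also as the quadratic function $e\mapsto\langle e|e\rangle$ on the total space of $E$. For $u\in\Gamma(E)$ let $\mathrm{d}_T(u)$ be its tangent lift, the vector field on the total space of $E$ whose value at the point $v(x)$, for $v\in\Gamma(E)$ and $x\in M$, is $$T_xv\big(\rho(u(x))\big)-[u,v](x)^{\mathrm{vert}}_{v(x)},$$ where $w^{\mathrm{vert}}_{e}$ is the velocity at $t=0$ of $t\mapsto e+tw$ (this value depends only on $u$ and on the point $v(x)$). If $(x^A,y^a)$ are the local coordinates on $E$ given by coordinates $x^A$ on $M$ and a local frame $(s_a)$, with $\rho(s_a)=Q_a^A\,\partial/\partial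 x^A$, $[s_a,s_b]=Q_{ab}^c s_c$ and $u=u^as_a$, then $$\mathrm{d}_T(u)=u^aQ_a^A\frac{\partial}{\partial x^A}+\Big(y^aQ_a^A\frac{\partial u^c}{\partial x^A}-y^au^bQ_{ba}^c\Big)\frac{\partial}{\partial y^c}.$$ The section $u$ is called a Killing section of $(E,G)$ if $\mathrm{d}_T(u)[G]=0$. Then: 1. The Killing sections of $(E,G)$ form a real Lie subalgebra $\mathrm{iso}(E,G)$ of $(\Gamma(E),[\cdot,\cdot])$. 2. Suppose that any two points of $M$ are joined by a finite chain of base curves of smooth admissible curves, an admissible curve being a smooth curve $a:[0,1]\to E$ whose base curve $x:[0,1]\to M$ satisfies $\dot x(t)=\rho(a(t))$ for all $t$. Then $\mathrm{iso}(E,G)$ is finite-dimensional and $\dim_{\mathbb R}\mathrm{iso}(E,G)\le n(n+1)/2$. -/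

import Mathlib

open scoped Manifold ContDiff Bundle Topology
open Bundle

noncomputable section

section Algebroid

variable {V : Type*} [NormedAddCommGroup V] [NormedSpace ℝ V]
  {M : Type*} [TopologicalSpace M] [ChartedSpace V M] [IsManifold 𝓘(ℝ, V) ∞ M]
  {F : Type*} [NormedAddCommGroup F] [NormedSpace ℝ F]
  {E : M → Type*} [TopologicalSpace (TotalSpace F E)]
  [∀ x, AddCommGroup (E x)] [∀ x, Module ℝ (E x)] [∀ x, TopologicalSpace (E x)]
  [FiberBundle F E] [VectorBundle ℝ F E]

/-- The product `f v` of a smooth function `f` on `M` and a smooth section `v` of `E`. -/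
def ContMDiffSection.funSMul (f : C^∞⟮𝓘(ℝ, V), M; ℝ⟯) (v : Cₛ^∞⟮𝓘(ℝ, V); F, E⟯) :
    Cₛ^∞⟮𝓘(ℝ, V); F, E⟯ :=
  ⟨fun x ↦ f x • v x, ContMDiff.smul_section f.contMDiff v.contMDiff⟩

/-- The derivative `ξ[f]` of a function `f` in the direction of a tangent vector `ξ` at `x`. -/
def dirDeriv (f : M → ℝ) (x : M) (ξ : TangentSpace 𝓘(ℝ, V) x) : ℝ :=
  mfderiv 𝓘(ℝ, V) 𝓘(ℝ, ℝ) f x ξ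

variable (V F E) in
/-- A Lie algebroid structure on the smooth vector bundle `E → M`: a smooth vector bundle morphism
`ρ : E → TM` over the identity (the anchor) and a real Lie bracket on the space of smooth sections
of `E` such that `[u, f v] = f [u, v] + ρ(u)[f] v`. -/
structure LieAlgebroid where
  /-- the anchor, fibre by fibre -/
  anchor : ∀ x : M, E x →L[ℝ] TangentSpace 𝓘(ℝ, V) x
  /-- the anchor is a smooth section of `Hom(E, TM)` -/
  contMDiff_anchor : ContMDiff 𝓘(ℝ, V) (𝓘(ℝ, V).prod 𝓘(ℝ, F →L[ℝ] V)) ∞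
    (fun x ↦ TotalSpace.mk' (F →L[ℝ] V)
      (E := fun x ↦ E x →L[ℝ] TangentSpace 𝓘(ℝ, V) x) x (anchor x))
  /-- the real bilinear bracket of sections -/
  bracket : Cₛ^∞⟮𝓘(ℝ, V); F, E⟯ →ₗ[ℝ] Cₛ^∞⟮𝓘(ℝ, V); F, E⟯ →ₗ[ℝ] Cₛ^∞⟮𝓘(ℝ, V); F, E⟯
  bracket_self : ∀ u, bracket u u = 0
  jacobi : ∀ u v w,
    bracket u (bracket v w) = bracket (bracket u v) w + bracket v (bracket u w)
  leibniz : ∀ (u v : Cₛ^∞⟮𝓘(ℝ, V); F, E⟯) (f : C^∞⟮𝓘(ℝ, V), M; ℝ⟯) (x : M),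
    bracket u (ContMDiffSection.funSMul f v) x =
      f x • bracket u v x + dirDeriv f x (anchor x (u x)) • v x

namespace LieAlgebroid

/-- The space of smooth sections of a Lie algebroid, regarded as a real Lie algebra under the
algebroid bracket. -/
def Sections (_A : LieAlgebroid V F E) : Type _ := Cₛ^∞⟮𝓘(ℝ, V); F, E⟯

variable (A : LieAlgebroid V F E)

instance : AddCommGroup A.Sections :=
  inferInstanceAs (AddCommGroup Cₛ^∞⟮𝓘(ℝ, V); F, E⟯)

instance : Module ℝ A.Sections :=
  inferInstanceAs (Module ℝ Cₛ^∞⟮𝓘(ℝ, V); F, E⟯)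

instance : DFunLike A.Sections M E :=
  inferInstanceAs (DFunLike Cₛ^∞⟮𝓘(ℝ, V); F, E⟯ M E)

instance : LieRing A.Sections where
  bracket u v := A.bracket u v
  add_lie u v w := by
    show A.bracket (u + v) w = A.bracket u w + A.bracket v w
    exact A.bracket.map_add₂ u v w
  lie_add u v w := (A.bracket u).map_add v w
  lie_self u := A.bracket_self u
  leibniz_lie u v w := A.jacobi u v w

instance : LieAlgebra ℝ A.Sections where
  lie_smul c u v := (A.bracket u).map_smul c v

end LieAlgebroid

/-- The vertical lift of `w ∈ E x` to the point `e ∈ E x` of the total space: the velocity at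
`t = 0` of the line `t ↦ e + t w` in the fibre. -/
def verticalLift {x : M} (e w : E x) :
    TangentSpace (𝓘(ℝ, V).prod 𝓘(ℝ, F)) (⟨x, e⟩ : TotalSpace F E) :=
  mfderiv 𝓘(ℝ, ℝ) (𝓘(ℝ, V).prod 𝓘(ℝ, F)) (fun t : ℝ ↦ (⟨x, e + t • w⟩ : TotalSpace F E)) 0
    (1 : ℝ)

namespace LieAlgebroid

variable (A : LieAlgebroid V F E)

/-- The vector `Tv(ρ(u)) - [u, v]` at the point `v x` of the total space. -/
def liftAlong (u v : A.Sections) (x : M) :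
    TangentSpace (𝓘(ℝ, V).prod 𝓘(ℝ, F)) (⟨x, v x⟩ : TotalSpace F E) :=
  mfderiv 𝓘(ℝ, V) (𝓘(ℝ, V).prod 𝓘(ℝ, F)) (fun y ↦ (⟨y, v y⟩ : TotalSpace F E)) x
      (A.anchor x (u x))
    - verticalLift (V := V) (F := F) (v x) (⁅u, v⁆ x)

/-- `p` and `q` are the end points of the base curve of a smooth admissible curve
`a : [0, 1] → E`, i.e. one whose base curve `x` satisfies `x'(t) = ρ(a(t))`. -/
def AdmissiblyJoined (p q : M) : Prop :=
  ∃ a : ℝ → TotalSpace F E,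
    ContMDiffOn 𝓘(ℝ, ℝ) (𝓘(ℝ, V).prod 𝓘(ℝ, F)) ∞ a (Set.Icc 0 1) ∧
    (∀ t ∈ Set.Icc (0 : ℝ) 1,
      HasMFDerivWithinAt 𝓘(ℝ, ℝ) 𝓘(ℝ, V) (fun s ↦ (a s).proj) (Set.Icc 0 1) t
        ((1 : ℝ →L[ℝ] ℝ).smulRight (A.anchor (a t).proj (a t).2))) ∧
    (a 0).proj = p ∧ (a 1).proj = q

/-- Admissible curves connect `M`: any two points are joined by a finite chain of smooth
admissible curves. -/
def AdmissiblyConnected : Prop :=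
  ∀ p q : M, Relation.ReflTransGen A.AdmissiblyJoined p q

theorem eval_sum {ι : Type*} (s : Finset ι) (v : ι → Cₛ^∞⟮𝓘(ℝ, V); F, E⟯) (y : M) :
    (∑ i ∈ s, v i) y = ∑ i ∈ s, v i y :=
  (congrFun (map_sum (ContMDiffSection.coeAddHom 𝓘(ℝ, V) F ∞ E) v s) y).trans
    (Finset.sum_apply _ _ _)

theorem verticalLift_eq {x : M} (e w : E x) :
    (verticalLift (V := V) (F := F) e w : V × F) =
      (0, (trivializationAt F E x ⟨x, w⟩).2) := by
  have key : HasMFDerivAt 𝓘(ℝ, ℝ) (𝓘(ℝ, V).prod 𝓘(ℝ, F))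
      (fun t : ℝ ↦ (⟨x, e + t • w⟩ : TotalSpace F E)) 0
      ((1 : ℝ →L[ℝ] ℝ).smulRight ((0, (trivializationAt F E x ⟨x, w⟩).2) : V × F)) := by
    set t := trivializationAt F E x
    have hx : x ∈ t.baseSet := FiberBundle.mem_baseSet_trivializationAt' x
    have hlin : ∀ s : ℝ, (t ⟨x, e + s • w⟩).2 = (t ⟨x, e⟩).2 + s • (t ⟨x, w⟩).2 := by
      intro s
      rw [(t.linear ℝ hx).1, (t.linear ℝ hx).2]
    have hd : MDifferentiableAt 𝓘(ℝ, ℝ) (𝓘(ℝ, V).prod 𝓘(ℝ, F))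
        (fun t : ℝ ↦ (⟨x, e + t • w⟩ : TotalSpace F E)) 0 := by
      rw [mdifferentiableAt_totalSpace]
      refine ⟨mdifferentiableAt_const, ?_⟩
      simp only [t] at hlin
      simp only [hlin]
      apply DifferentiableAt.mdifferentiableAt
      fun_prop
    refine ⟨hd.continuousAt, ?_⟩
    have h1 : HasFDerivWithinAt (fun s : ℝ ↦ (t ⟨x, e⟩).2 + s • (t ⟨x, w⟩).2)
       ((1 : ℝ →L[ℝ] ℝ).smulRight (t ⟨x, w⟩).2) (Set.range 𝓘(ℝ, ℝ)) (0 : ℝ) := by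
      have := ((((1 : ℝ →L[ℝ] ℝ).hasFDerivAt (x := 0)).smul_const (t ⟨x, w⟩).2).const_add
        (t ⟨x, e⟩).2).hasFDerivWithinAt (s := Set.range 𝓘(ℝ, ℝ))
      exact this
    have h2 := (hasFDerivWithinAt_const (extChartAt 𝓘(ℝ, V) x x) (0 : ℝ)
      (Set.range 𝓘(ℝ, ℝ))).prodMk h1
    have h3 : ∀ s : ℝ, writtenInExtChartAt 𝓘(ℝ, ℝ) (𝓘(ℝ, V).prod 𝓘(ℝ, F)) (0 : ℝ)
      (fun t : ℝ ↦ (⟨x, e + t • w⟩ : TotalSpace F E)) s =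
        (extChartAt 𝓘(ℝ, V) x x, (t ⟨x, e⟩).2 + s • (t ⟨x, w⟩).2) := by
      intro s
      change extChartAt (𝓘(ℝ, V).prod 𝓘(ℝ, F)) (⟨x, e + (0 : ℝ) • w⟩ : TotalSpace F E)
        ⟨x, e + s • w⟩ = _
      rw [FiberBundle.extChartAt, ← hlin]
      refine Prod.ext ?_ rfl
      exact congrArg (extChartAt 𝓘(ℝ, V) x) (t.coe_fst' (x := ⟨x, e + s • w⟩) hx)
    rw [funext h3]
    have h4 : ((1 : ℝ →L[ℝ] ℝ).smulRight ((0, (t ⟨x, w⟩).2) : V × F)) =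
        ContinuousLinearMap.prod 0 ((1 : ℝ →L[ℝ] ℝ).smulRight (t ⟨x, w⟩).2) := by
      ext <;> simp
    rw [← h4] at h2
    exact h2
  refine (congrArg (fun f : ℝ →L[ℝ] V × F ↦ f 1) key.mfderiv).trans ?_
  exact one_smul ℝ _

theorem mfderiv_section_eq (v : A.Sections) (x : M) (ξ : V) :
    (mfderiv 𝓘(ℝ, V) (𝓘(ℝ, V).prod 𝓘(ℝ, F))
      (fun y ↦ (⟨y, v y⟩ : TotalSpace F E)) x ξ : V × F) =
    (ξ, mfderiv 𝓘(ℝ, V) 𝓘(ℝ, F) (fun y ↦ (trivializationAt F E x ⟨y, v y⟩).2) x ξ) := by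
  have hv : MDifferentiableAt 𝓘(ℝ, V) (𝓘(ℝ, V).prod 𝓘(ℝ, F))
      (fun y ↦ (⟨y, v y⟩ : TotalSpace F E)) x := ContMDiffSection.mdifferentiableAt v
  have hZ : MDifferentiableAt 𝓘(ℝ, V) 𝓘(ℝ, F)
      (fun y ↦ (trivializationAt F E x ⟨y, v y⟩).2) x := by
    have := (Bundle.contMDiffAt_section (n := ∞) x).1 (ContMDiffSection.contMDiff v x)
    exact this.mdifferentiableAt (by simp)
  have key : HasMFDerivAt 𝓘(ℝ, V) (𝓘(ℝ, V).prod 𝓘(ℝ, F))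
      (fun y ↦ (⟨y, v y⟩ : TotalSpace F E)) x
      ((ContinuousLinearMap.id ℝ V).prod
        (mfderiv 𝓘(ℝ, V) 𝓘(ℝ, F) (fun y ↦ (trivializationAt F E x ⟨y, v y⟩).2) x)) := by
    refine ⟨hv.continuousAt, ?_⟩
    have h2 := hZ.hasMFDerivAt.2
    have h1 : HasFDerivWithinAt (fun y : V ↦ y) (ContinuousLinearMap.id ℝ V) (Set.range 𝓘(ℝ, V))
      (extChartAt 𝓘(ℝ, V) x x) := hasFDerivWithinAt_id _ _
    refine (h1.prodMk h2).congr_of_eventuallyEq ?_ ?_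
    · have hb : (trivializationAt F E x).baseSet ∈ 𝓝 x :=
        (trivializationAt F E x).open_baseSet.mem_nhds (FiberBundle.mem_baseSet_trivializationAt' x)
      filter_upwards [extChartAt_target_mem_nhdsWithin (I := 𝓘(ℝ, V)) x,
        mem_nhdsWithin_of_mem_nhds (extChartAt_preimage_mem_nhds (I := 𝓘(ℝ, V)) hb)] with y hy hyb
      have := (extChartAt 𝓘(ℝ, V) x).right_inv hy
      change extChartAt (𝓘(ℝ, V).prod 𝓘(ℝ, F)) (⟨x, v x⟩ : TotalSpace F E) _ = _
      rw [FiberBundle.extChartAt]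
      refine Prod.ext ?_ rfl
      refine Eq.trans ?_ this
      exact congrArg (extChartAt 𝓘(ℝ, V) x)
        ((trivializationAt F E x).coe_fst' (x := ⟨_, v _⟩) hyb)
    · change extChartAt (𝓘(ℝ, V).prod 𝓘(ℝ, F)) (⟨x, v x⟩ : TotalSpace F E) _ = _
      rw [FiberBundle.extChartAt]
      refine Prod.ext ?_ rfl
      have h0 := extChartAt_to_inv (I := 𝓘(ℝ, V)) x
      refine congrArg (extChartAt 𝓘(ℝ, V) x)
        (((trivializationAt F E x).coe_fst' (x := ⟨_, v _⟩) ?_).trans h0)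
      change (extChartAt 𝓘(ℝ, V) x).symm (extChartAt 𝓘(ℝ, V) x x) ∈ _
      rw [h0]
      exact FiberBundle.mem_baseSet_trivializationAt' x
  exact congrArg (fun f : V →L[ℝ] V × F ↦ f ξ) key.mfderiv

variable [FiniteDimensional ℝ V] [T2Space M] [ContMDiffVectorBundle ∞ F E 𝓘(ℝ, V)]

theorem exists_bump (x : M) {s : Set M} (hs : s ∈ 𝓝 x) :
    ∃ φ : C^∞⟮𝓘(ℝ, V), M; ℝ⟯, tsupport φ ⊆ s ∧ ∀ᶠ y in 𝓝 x, φ y = 1 := by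
  obtain ⟨φ, -, hφ⟩ := (SmoothBumpFunction.nhds_basis_tsupport (I := 𝓘(ℝ, V)) x).mem_iff.1 hs
  exact ⟨⟨φ, φ.contMDiff⟩, hφ, φ.eventuallyEq_one⟩

/-- Every point of the total space lies on a global smooth section. -/
theorem exists_section (e : TotalSpace F E) :
    ∃ v : A.Sections, (⟨e.proj, v e.proj⟩ : TotalSpace F E) = e := by
  obtain ⟨s, hs, h⟩ := FiberBundle.exists_contMDiffOn_extend (k := ∞) 𝓘(ℝ, V) F e.2
  obtain ⟨φ, hφ, h1⟩ := exists_bump (V := V) e.proj (interior_mem_nhds.2 hs)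
  refine ⟨⟨_, ContMDiffOn.smul_section_of_tsupport (ψ := φ) φ.contMDiff.contMDiffOn
    isOpen_interior hφ (h.mono interior_subset)⟩, ?_⟩
  obtain ⟨p, w⟩ := e
  rw [TotalSpace.mk_inj]
  have h2 : (φ : M → ℝ) p = 1 := h1.self_of_nhds
  exact (congrArg (fun c : ℝ ↦ c • FiberBundle.extend F w p) h2).trans
    ((one_smul ℝ _).trans (FiberBundle.extend_apply_self F w))

variable [FiniteDimensional ℝ F]

theorem bracket_of_zero (u z : Cₛ^∞⟮𝓘(ℝ, V); F, E⟯) (x : M) (h : z x = 0) :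
    (trivializationAt F E x ⟨x, A.bracket u z x⟩).2 =
      mfderiv 𝓘(ℝ, V) 𝓘(ℝ, F) (fun y ↦ (trivializationAt F E x ⟨y, z y⟩).2) x
        (A.anchor x (u x)) := by
  set t := trivializationAt F E x with ht
  have hx : x ∈ t.baseSet := FiberBundle.mem_baseSet_trivializationAt' x
  obtain ⟨φ, hφ, h1⟩ := exists_bump (V := V) x (t.open_baseSet.mem_nhds hx)
  have hφx : φ x = 1 := h1.self_of_nhds
  let b := Module.finBasis ℝ F
  -- the cut-off frame
  let S : Fin (Module.finrank ℝ F) → Cₛ^∞⟮𝓘(ℝ, V); F, E⟯ := fun i ↦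
    ⟨_, ContMDiffOn.smul_section_of_tsupport (ψ := φ) φ.contMDiff.contMDiffOn
      t.open_baseSet hφ (t.contMDiffOn_localFrame_baseSet (I := 𝓘(ℝ, V)) ∞ b i)⟩
  have hZ : ContMDiffOn 𝓘(ℝ, V) 𝓘(ℝ, F) ∞ (fun y ↦ (t ⟨y, z y⟩).2) t.baseSet :=
    t.contMDiffOn_section_baseSet_iff.1 (ContMDiffSection.contMDiff z).contMDiffOn
  have hZx : MDifferentiableAt 𝓘(ℝ, V) 𝓘(ℝ, F) (fun y ↦ (t ⟨y, z y⟩).2) x :=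
    (hZ.contMDiffAt (t.open_baseSet.mem_nhds hx)).mdifferentiableAt (by simp)
  -- the cut-off coefficients
  have hf : ∀ i, ContMDiff 𝓘(ℝ, V) 𝓘(ℝ, ℝ) ∞
      (fun y ↦ φ y • (b.coord i).toContinuousLinearMap (t ⟨y, z y⟩).2) := by
    intro i
    refine contMDiff_of_tsupport fun y hy ↦ ?_
    have hy' : y ∈ t.baseSet := hφ (tsupport_smul_subset_left _ _ hy)
    exact (φ.contMDiff y).smul ((ContinuousLinearMap.contMDiff _).contMDiffAt.comp y
      (hZ.contMDiffAt (t.open_baseSet.mem_nhds hy')))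
  let f : Fin (Module.finrank ℝ F) → C^∞⟮𝓘(ℝ, V), M; ℝ⟯ := fun i ↦ ⟨_, hf i⟩
  have hsum : A.bracket u (ContMDiffSection.funSMul (φ * φ) z) =
      ∑ i, A.bracket u (ContMDiffSection.funSMul (f i) (S i)) := by
    rw [← map_sum]
    congr 1
    refine ContMDiffSection.ext fun y ↦ ?_
    rw [eval_sum]
    change (φ y * φ y) • z y = ∑ i, (φ y • b.repr (t ⟨y, z y⟩).2 i) • (φ y • t.localFrame b i y)
    by_cases hy : y ∈ t.baseSet
    · conv_lhs => rw [show z y = _ from Trivialization.eq_sum_localFrameCoeff_smul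
        (I := 𝓘(ℝ, V)) (b := b) (e := t) (s := fun y ↦ z y) hy]
      rw [Finset.smul_sum]
      refine Finset.sum_congr rfl fun i _ ↦ ?_
      rw [t.localFrameCoeff_apply_of_mem_baseSet b hy (fun y ↦ z y) i]
      simp only [smul_smul, smul_eq_mul]
      have hr : (t.basisAt b hy).repr (z y) i = b.repr (t ⟨y, z y⟩).2 i := by
        simp [Trivialization.basisAt]
      rw [hr]
      ring_nf
    · have : φ y = 0 := image_eq_zero_of_notMem_tsupport fun h' ↦ hy (hφ h')
      simp [this]
  have hd : ∀ i, dirDeriv (f i) x (A.anchor x (u x)) =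
      b.coord i (mfderiv 𝓘(ℝ, V) 𝓘(ℝ, F) (fun y ↦ (t ⟨y, z y⟩).2) x (A.anchor x (u x))) := by
    intro i
    have he : (f i : M → ℝ) =ᶠ[𝓝 x]
        (b.coord i).toContinuousLinearMap ∘ fun y ↦ (t ⟨y, z y⟩).2 := by
      filter_upwards [h1] with y hy
      change φ y • b.coord i (t ⟨y, z y⟩).2 = _
      rw [hy, one_smul]
      rfl
    have hc := ((b.coord i).toContinuousLinearMap.hasMFDerivAt
      (x := (t ⟨x, z x⟩).2)).comp x hZx.hasMFDerivAt
    rw [dirDeriv, he.mfderiv_eq, hc.mfderiv]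
    rfl
  have hl := A.leibniz u z (φ * φ) x
  have h2 : A.bracket u z x = ∑ i, A.bracket u (ContMDiffSection.funSMul (f i) (S i)) x := by
    rw [← eval_sum, ← hsum, hl, h, smul_zero, add_zero]
    change _ = (φ x * φ x) • _
    rw [hφx, mul_one, one_smul]
  have h3 : ∀ i, A.bracket u (ContMDiffSection.funSMul (f i) (S i)) x =
      (b.coord i (mfderiv 𝓘(ℝ, V) 𝓘(ℝ, F) (fun y ↦ (t ⟨y, z y⟩).2) x (A.anchor x (u x)))) •
        t.localFrame b i x := by
    intro i
    rw [A.leibniz, hd]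
    have hf0 : f i x = 0 := by
      change φ x • b.coord i (t ⟨x, z x⟩).2 = 0
      rw [h, show (t ⟨x, 0⟩).2 = 0 from (t.linear ℝ hx).map_zero, map_zero, smul_zero]
    have hS : S i x = t.localFrame b i x := by
      change φ x • t.localFrame b i x = _
      rw [hφx, one_smul]
    rw [hf0, zero_smul, zero_add, hS]
  have h4 : ∀ w : E x, (t ⟨x, w⟩).2 = t.linearMapAt ℝ x w := fun w ↦ by
    rw [Trivialization.coe_linearMapAt_of_mem (R := ℝ) t hx]
  rw [h4, h2, map_sum]
  conv_rhs => rw [← b.sum_repr ((mfderiv 𝓘(ℝ, V) 𝓘(ℝ, F) (fun y ↦ (t ⟨y, z y⟩).2) x)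
    (A.anchor x (u x)))]
  refine Finset.sum_congr rfl fun i _ ↦ ?_
  rw [h3, map_smul, ← h4, t.localFrame_apply_of_mem_baseSet b hx]
  have hb : (t ⟨x, t.basisAt b hx i⟩).2 = b i := by
    rw [Trivialization.basisAt, Module.Basis.map_apply]
    exact (t.linearEquivAt ℝ x hx).apply_symm_apply (b i)
  rw [hb]
  rfl

/-- The tangent vector `Tv(ρ(u)) - [u, v]` depends only on the value of `v` at the point. -/
theorem liftAlong_congr (u v w : A.Sections) (x : M) (h : v x = w x) :
    (A.liftAlong u v x : V × F) = A.liftAlong u w x := by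
  set t := trivializationAt F E x with ht
  have hx : x ∈ t.baseSet := FiberBundle.mem_baseSet_trivializationAt' x
  have h4 : ∀ w : E x, (t ⟨x, w⟩).2 = t.linearMapAt ℝ x w := fun w ↦ by
    rw [Trivialization.coe_linearMapAt_of_mem (R := ℝ) t hx]
  let DZ : A.Sections → F := fun v ↦
    mfderiv 𝓘(ℝ, V) 𝓘(ℝ, F) (fun y ↦ (t ⟨y, v y⟩).2) x (A.anchor x (u x))
  have key : ∀ v : A.Sections, (A.liftAlong u v x : V × F) =
      (A.anchor x (u x), DZ v - (t ⟨x, ⁅u, v⁆ x⟩).2) := by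
    intro v
    refine (congrArg₂ (fun a b : V × F ↦ a - b) (A.mfderiv_section_eq v x (A.anchor x (u x)))
      (verticalLift_eq (V := V) (F := F) (v x) (⁅u, v⁆ x))).trans ?_
    exact Prod.ext (sub_zero _) rfl
  have hz := A.bracket_of_zero u (v - w) x (sub_eq_zero.2 h)
  have hbr : (t ⟨x, A.bracket u (v - w) x⟩).2 = (t ⟨x, ⁅u, v⁆ x⟩).2 - (t ⟨x, ⁅u, w⁆ x⟩).2 := by
    rw [h4, h4, h4, ← map_sub]
    exact congrArg (fun s : Cₛ^∞⟮𝓘(ℝ, V); F, E⟯ ↦ t.linearMapAt ℝ x (s x))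
      ((A.bracket u).map_sub v w)
  have hdiff : ∀ v : A.Sections, MDifferentiableAt 𝓘(ℝ, V) 𝓘(ℝ, F)
      (fun y ↦ (t ⟨y, v y⟩).2) x := fun v ↦
    ((Bundle.contMDiffAt_section (n := ∞) x).1
      (ContMDiffSection.contMDiff v x)).mdifferentiableAt (by simp)
  have hDZ : DZ (v - w) = DZ v - DZ w := by
    have he : (fun y ↦ (t ⟨y, (v - w) y⟩).2) =ᶠ[𝓝 x]
        (fun y ↦ (t ⟨y, v y⟩).2) - fun y ↦ (t ⟨y, w y⟩).2 := by
      filter_upwards [t.open_baseSet.mem_nhds hx] with y hy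
      have h5 : ∀ w : E y, (t ⟨y, w⟩).2 = t.linearMapAt ℝ y w := fun w ↦ by
        rw [Trivialization.coe_linearMapAt_of_mem (R := ℝ) t hy]
      simp only [Pi.sub_apply, h5]
      exact map_sub _ _ _
    have := ((hdiff v).hasMFDerivAt.sub (hdiff w).hasMFDerivAt).congr_of_eventuallyEq he
    exact congrArg (fun f : V →L[ℝ] F ↦ f (A.anchor x (u x))) this.mfderiv
  refine (key v).trans (Eq.trans ?_ (key w).symm)
  refine Prod.ext rfl ?_
  have hz' : (t ⟨x, ⁅u, v⁆ x⟩).2 - (t ⟨x, ⁅u, w⁆ x⟩).2 = DZ v - DZ w :=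
    hbr.symm.trans (hz.trans hDZ)
  exact (sub_eq_sub_iff_sub_eq_sub.2 hz'.symm)

/-- The tangent lift `d_T(u)` of a section `u`, a vector field on the total space of `E`: at the
point `e = v(x)`, for a smooth section `v` through `e`, its value is `Tv(ρ(u)(x)) - [u, v](x)`,
where `[u, v](x)` is lifted vertically. By `tangentLift_apply` any such `v` gives the same value.
In local coordinates `(x^A, y^a)` of `E` this is
`u^a Q_a^A ∂/∂x^A + (y^a Q_a^A ∂u^c/∂x^A - y^a u^b Q_{ba}^c) ∂/∂y^c`. -/
def tangentLift (u : A.Sections) (e : TotalSpace F E) :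
    TangentSpace (𝓘(ℝ, V).prod 𝓘(ℝ, F)) e :=
  (A.exists_section e).choose_spec ▸ A.liftAlong u (A.exists_section e).choose e.proj

theorem tangentLift_apply (u v : A.Sections) (x : M) :
    A.tangentLift u ⟨x, v x⟩ = A.liftAlong u v x := by
  have key : ∀ (e e' : TotalSpace F E) (h : e = e')
      (X : TangentSpace (𝓘(ℝ, V).prod 𝓘(ℝ, F)) e),
      (show V × F from (h ▸ X : TangentSpace (𝓘(ℝ, V).prod 𝓘(ℝ, F)) e')) = X := by
    rintro e _ rfl X; rfl
  refine (key _ _ _ _).trans (A.liftAlong_congr u _ v x ?_)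
  have := (A.exists_section (⟨x, v x⟩ : TotalSpace F E)).choose_spec
  rwa [TotalSpace.mk_inj] at this

/-- A section `u` is a Killing section of the Riemannian Lie algebroid `(E, G)` if
`d_T(u)[G] = 0`, where `G` is regarded as the quadratic function `e ↦ ⟨e | e⟩` on the total space
of `E`. -/
def IsKilling [∀ x, IsTopologicalAddGroup (E x)] [∀ x, ContinuousConstSMul ℝ (E x)]
    (G : ContMDiffRiemannianMetric 𝓘(ℝ, V) ∞ F E) (u : A.Sections) : Prop :=
  ∀ e : TotalSpace F E,
    mfderiv (𝓘(ℝ, V).prod 𝓘(ℝ, F)) 𝓘(ℝ, ℝ) (fun e : TotalSpace F E ↦ G.inner e.proj e.2 e.2) e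
      (A.tangentLift u e) = 0

end LieAlgebroid

end Algebroid

end

/-! Evaluating `tangentLift` on `G` turns the Killing condition into ρ(u)⟨v|w⟩ = ⟨[u,v]|w⟩ +
⟨v|[u,w]⟩ for all sections v, w (`isKilling_iff`, `IsKilling.act_pairing`). Thus u is Killing when
ρ(u) and [u,·] together act as a derivation of the pairing. Commutators of such operators are again
of this kind, by the Jacobi identity and because the anchor preserves brackets (`act_lie`); this
gives the subalgebra.

For the dimension, the Killing equation is prolonged without choosing a connection: brackets of u
with a local frame (s_i) play the role of its first derivatives. Let J(u) consist of the functions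
⟨u|s_j⟩ and ⟨[u,s_i]|s_j⟩, and work modulo functions that are O(J(u)) near a point. Then T(a,b,c) =
ρ(a)⟨[u,b]|c⟩ is symmetric in a, b by Jacobi and skew in b, c by the Killing equation, hence zero.
So along an admissible curve the derivative of J(u) is bounded by J(u), and Grönwall's inequality
carries the vanishing of J(u) along the curve. On an admissibly connected base a Killing section is
therefore determined by J(u) at one point. Where u vanishes, ⟨[u,s_i]|s_j⟩ is skew in i, j, which
leaves n + n(n-1)/2 parameters. -/

noncomputable section

set_option linter.unusedSectionVars false

namespace LieAlgebroid

variable {V : Type*} [NormedAddCommGroup V] [NormedSpace ℝ V]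
  {M : Type*} [TopologicalSpace M] [ChartedSpace V M] [IsManifold 𝓘(ℝ, V) ∞ M]
  {F : Type*} [NormedAddCommGroup F] [NormedSpace ℝ F]
  {E : M → Type*} [TopologicalSpace (TotalSpace F E)]
  [∀ x, AddCommGroup (E x)] [∀ x, Module ℝ (E x)] [∀ x, TopologicalSpace (E x)]
  [FiberBundle F E] [VectorBundle ℝ F E]

/-! ### Sections as a module over the smooth functions. -/

section Sections

variable (A : LieAlgebroid V F E)

@[simp] theorem Sections.add_apply (u v : A.Sections) (x : M) : (u + v) x = u x + v x := rfl

@[simp] theorem Sections.sub_apply (u v : A.Sections) (x : M) : (u - v) x = u x - v x := rfl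

@[simp] theorem Sections.real_smul_apply (c : ℝ) (u : A.Sections) (x : M) :
    (c • u) x = c • u x := rfl

theorem Sections.sum_apply {ι : Type*} (s : Finset ι) (v : ι → A.Sections) (x : M) :
    (∑ i ∈ s, v i) x = ∑ i ∈ s, v i x := eval_sum s v x

theorem Sections.ext {u v : A.Sections} (h : ∀ x, u x = v x) : u = v :=
  ContMDiffSection.ext (s := u) (t := v) h

/-- Sections form a module over the smooth functions. -/
instance : Module C^∞⟮𝓘(ℝ, V), M; ℝ⟯ A.Sections where
  smul f v := ContMDiffSection.funSMul f v
  one_smul v := Sections.ext A fun x ↦ one_smul ℝ (v x)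
  mul_smul f g v := Sections.ext A fun x ↦ mul_smul (f x) (g x) (v x)
  smul_zero f := Sections.ext A fun x ↦ smul_zero (f x)
  smul_add f v w := Sections.ext A fun x ↦ smul_add (f x) (v x) (w x)
  add_smul f g v := Sections.ext A fun x ↦ add_smul (f x) (g x) (v x)
  zero_smul v := Sections.ext A fun x ↦ zero_smul ℝ (v x)

variable {A} in
theorem Sections.contMDiff (v : A.Sections) :
    ContMDiff 𝓘(ℝ, V) (𝓘(ℝ, V).prod 𝓘(ℝ, F)) ∞ (fun x ↦ (⟨x, v x⟩ : TotalSpace F E)) :=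
  ContMDiffSection.contMDiff (v : Cₛ^∞⟮𝓘(ℝ, V); F, E⟯)

end Sections

/-! ### The anchor as an action by derivations. -/

section Action

theorem contMDiff_dirDeriv [ContMDiffVectorBundle ∞ F E 𝓘(ℝ, V)] (A : LieAlgebroid V F E)
    (u : A.Sections) (f : C^∞⟮𝓘(ℝ, V), M; ℝ⟯) :
    ContMDiff 𝓘(ℝ, V) 𝓘(ℝ, ℝ) ∞ (fun x ↦ dirDeriv f x (A.anchor x (u x))) := by
  have h1 : ContMDiff 𝓘(ℝ, V) (𝓘(ℝ, V).prod 𝓘(ℝ, V)) ∞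
      (fun x ↦ (⟨x, A.anchor x (u x)⟩ : TotalSpace V (TangentSpace 𝓘(ℝ, V) : M → Type _))) :=
    ContMDiff.clm_bundle_apply (F₁ := F) (E₁ := E) (F₂ := V)
      (E₂ := (TangentSpace 𝓘(ℝ, V) : M → Type _)) A.contMDiff_anchor u.contMDiff
  have h2 := f.contMDiff.contMDiff_tangentMap (m := ∞) (by simp)
  have h3 := contMDiff_snd_tangentBundle_modelSpace (n := ∞) ℝ 𝓘(ℝ, ℝ)
  exact h3.comp (h2.comp h1)

variable [ContMDiffVectorBundle ∞ F E 𝓘(ℝ, V)] (A : LieAlgebroid V F E)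

theorem _root_.ContMDiffMap.mdifferentiableAt_real (f : C^∞⟮𝓘(ℝ, V), M; ℝ⟯) (x : M) :
    MDifferentiableAt 𝓘(ℝ, V) 𝓘(ℝ, ℝ) f x :=
  (f.contMDiff x).mdifferentiableAt (by simp)

/-- The action of sections on smooth functions by derivations, through the anchor. -/
def act : A.Sections →ₗ[C^∞⟮𝓘(ℝ, V), M; ℝ⟯]
    Derivation ℝ C^∞⟮𝓘(ℝ, V), M; ℝ⟯ C^∞⟮𝓘(ℝ, V), M; ℝ⟯ where
  toFun u := Derivation.mk'
    { toFun := fun f ↦ ⟨fun x ↦ dirDeriv f x (A.anchor x (u x)), A.contMDiff_dirDeriv u f⟩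
      map_add' := fun f g ↦ ContMDiffMap.ext fun x ↦
        congrArg (fun L : V →L[ℝ] ℝ ↦ L (A.anchor x (u x)))
          (mfderiv_add (f.mdifferentiableAt_real x) (g.mdifferentiableAt_real x))
      map_smul' := fun c f ↦ ContMDiffMap.ext fun x ↦
        congrArg (fun L : V →L[ℝ] ℝ ↦ L (A.anchor x (u x)))
          (const_smul_mfderiv (f.mdifferentiableAt_real x) c) }
    (fun f g ↦ ContMDiffMap.ext fun x ↦
      congrArg (fun L : V →L[ℝ] ℝ ↦ L (A.anchor x (u x)))
          ((f.mdifferentiableAt_real x).hasMFDerivAt.mul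
            (g.mdifferentiableAt_real x).hasMFDerivAt).mfderiv)
  map_add' u v := Derivation.ext fun f ↦ ContMDiffMap.ext fun x ↦ by
    change dirDeriv f x (A.anchor x (u x + v x)) = _
    rw [map_add]
    exact map_add (mfderiv 𝓘(ℝ, V) 𝓘(ℝ, ℝ) f x) _ _
  map_smul' g u := Derivation.ext fun f ↦ ContMDiffMap.ext fun x ↦ by
    change dirDeriv f x (A.anchor x (g x • u x)) = _
    rw [map_smul]
    exact map_smul (mfderiv 𝓘(ℝ, V) 𝓘(ℝ, ℝ) f x) _ _

theorem act_apply (u : A.Sections) (f : C^∞⟮𝓘(ℝ, V), M; ℝ⟯) (x : M) :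
    A.act u f x = dirDeriv f x (A.anchor x (u x)) := rfl

theorem lie_fun_smul (u v : A.Sections) (f : C^∞⟮𝓘(ℝ, V), M; ℝ⟯) :
    ⁅u, f • v⁆ = f • ⁅u, v⁆ + A.act u f • v :=
  Sections.ext A fun x ↦ A.leibniz u v f x

variable [FiniteDimensional ℝ V] [T2Space M]

theorem exists_section_apply {x : M} (e : E x) : ∃ v : A.Sections, v x = e := by
  obtain ⟨v, hv⟩ := A.exists_section (⟨x, e⟩ : TotalSpace F E)
  exact ⟨v, by rwa [TotalSpace.mk_inj] at hv⟩

/-- The anchor is a morphism of Lie algebras. -/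
theorem act_lie (u v : A.Sections) (f : C^∞⟮𝓘(ℝ, V), M; ℝ⟯) :
    A.act ⁅u, v⁆ f = A.act u (A.act v f) - A.act v (A.act u f) := by
  refine ContMDiffMap.ext fun x ↦ ?_
  -- Jacobi applied to `f • s` gives the identity only multiplied by `s`, so a section with `s x ≠
  -- 0` is needed to cancel it. If the fibre is zero, every derivation in sight vanishes at `x`.
  by_cases hx : ∃ e : E x, e ≠ 0
  · obtain ⟨e, he⟩ := hx
    obtain ⟨s, rfl⟩ := A.exists_section_apply e
    have h := leibniz_lie u v (f • s)
    simp only [lie_fun_smul, lie_add] at h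
    have h2 : A.act ⁅u, v⁆ f • s = (A.act u (A.act v f) - A.act v (A.act u f)) • s := by
      rw [leibniz_lie u v s] at h
      rw [sub_smul, eq_sub_iff_add_eq]
      have h' := sub_eq_zero.2 h
      rw [← sub_eq_zero, ← neg_eq_zero, ← h']
      simp only [smul_add]
      abel
    exact smul_left_injective ℝ he (congrArg (fun w : A.Sections ↦ w x) h2)
  · push Not at hx
    have h0 : ∀ (w : A.Sections) (g : C^∞⟮𝓘(ℝ, V), M; ℝ⟯), A.act w g x = 0 := fun w g ↦ by
      rw [act_apply, hx (w x), map_zero]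
      exact map_zero (mfderiv 𝓘(ℝ, V) 𝓘(ℝ, ℝ) g x)
    rw [h0]
    exact ((congrArg₂ (fun a b : ℝ ↦ a - b) (h0 u (A.act v f)) (h0 v (A.act u f))).trans
      (sub_zero 0)).symm

end Action

/-! ### The Killing equation on the base and the Lie subalgebra. -/

section Killing

variable [ContMDiffVectorBundle ∞ F E 𝓘(ℝ, V)] (A : LieAlgebroid V F E)
  [∀ x, IsTopologicalAddGroup (E x)] [∀ x, ContinuousConstSMul ℝ (E x)]
  (G : ContMDiffRiemannianMetric 𝓘(ℝ, V) ∞ F E)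

theorem contMDiff_inner (v w : A.Sections) :
    ContMDiff 𝓘(ℝ, V) 𝓘(ℝ, ℝ) ∞ (fun x ↦ G.inner x (v x) (w x)) := by
  intro x
  have h := ContMDiffAt.clm_bundle_apply₂ (F₁ := F) (F₂ := F) (F₃ := ℝ) (E₃ := Bundle.Trivial M ℝ)
    (G.contMDiff x) (v.contMDiff x) (w.contMDiff x)
  exact (contMDiffAt_totalSpace.1 h).2

/-- The function `⟨v | w⟩` on the base, bilinear over the smooth functions. -/
def pairing : A.Sections →ₗ[C^∞⟮𝓘(ℝ, V), M; ℝ⟯] A.Sections →ₗ[C^∞⟮𝓘(ℝ, V), M; ℝ⟯]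
    C^∞⟮𝓘(ℝ, V), M; ℝ⟯ :=
  LinearMap.mk₂ _ (fun v w ↦ ⟨_, A.contMDiff_inner G v w⟩)
    (fun v v' w ↦ ContMDiffMap.ext fun x ↦ by
      change G.inner x (v x + v' x) (w x) = _
      rw [map_add]; rfl)
    (fun f v w ↦ ContMDiffMap.ext fun x ↦ by
      change G.inner x (f x • v x) (w x) = _
      rw [map_smul]; rfl)
    (fun v w w' ↦ ContMDiffMap.ext fun x ↦ map_add (G.inner x (v x)) (w x) (w' x))
    (fun f v w ↦ ContMDiffMap.ext fun x ↦ map_smul (G.inner x (v x)) (f x) (w x))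

theorem pairing_apply (v w : A.Sections) (x : M) :
    A.pairing G v w x = G.inner x (v x) (w x) := rfl

theorem pairing_comm (v w : A.Sections) : A.pairing G v w = A.pairing G w v :=
  ContMDiffMap.ext fun x ↦ G.symm x (v x) (w x)

theorem contMDiff_quadratic :
    ContMDiff (𝓘(ℝ, V).prod 𝓘(ℝ, F)) 𝓘(ℝ, ℝ) ∞
      (fun e : TotalSpace F E ↦ G.inner e.proj e.2 e.2) := by
  intro e
  have hp : ContMDiff (𝓘(ℝ, V).prod 𝓘(ℝ, F)) 𝓘(ℝ, V) ∞
      (fun e : TotalSpace F E ↦ e.proj) := contMDiff_proj E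
  have hid : ContMDiffAt (𝓘(ℝ, V).prod 𝓘(ℝ, F)) (𝓘(ℝ, V).prod 𝓘(ℝ, F)) ∞
      (fun e : TotalSpace F E ↦ (⟨e.proj, e.2⟩ : TotalSpace F E)) e := contMDiffAt_id
  have h := ContMDiffAt.clm_bundle_apply₂ (F₁ := F) (F₂ := F) (F₃ := ℝ) (E₃ := Bundle.Trivial M ℝ)
    (b := fun e : TotalSpace F E ↦ e.proj)
    ((G.contMDiff.comp hp) e) hid hid
  exact (contMDiffAt_totalSpace.1 h).2

theorem mdifferentiable_fibreLine {x : M} (e w : E x) :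
    MDifferentiableAt 𝓘(ℝ, ℝ) (𝓘(ℝ, V).prod 𝓘(ℝ, F))
      (fun t : ℝ ↦ (⟨x, e + t • w⟩ : TotalSpace F E)) 0 := by
  have hx : x ∈ (trivializationAt F E x).baseSet := FiberBundle.mem_baseSet_trivializationAt' x
  rw [mdifferentiableAt_totalSpace]
  refine ⟨mdifferentiableAt_const, ?_⟩
  simp only [(Trivialization.linear (e := trivializationAt F E x) ℝ hx).1,
    (Trivialization.linear (e := trivializationAt F E x) ℝ hx).2]
  apply DifferentiableAt.mdifferentiableAt
  fun_prop

variable [FiniteDimensional ℝ V] [T2Space M] [FiniteDimensional ℝ F]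

/-- The chain rule along the section `v` turns the horizontal term into ρ(u)⟨v|v⟩; the vertical term
is the derivative at 0 of t ↦ ⟨v + tw|v + tw⟩ with w = [u,v]. -/
theorem mfderiv_quadratic_tangentLift (u v : A.Sections) (x : M) :
    mfderiv (𝓘(ℝ, V).prod 𝓘(ℝ, F)) 𝓘(ℝ, ℝ)
      (fun e : TotalSpace F E ↦ G.inner e.proj e.2 e.2) ⟨x, v x⟩ (A.tangentLift u ⟨x, v x⟩) =
    (A.act u (A.pairing G v v) x - 2 * A.pairing G ⁅u, v⁆ v x : ℝ) := by
  rw [A.tangentLift_apply, liftAlong]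
  set q := fun e : TotalSpace F E ↦ G.inner e.proj e.2 e.2 with hq
  have hqd : ∀ e, MDifferentiableAt (𝓘(ℝ, V).prod 𝓘(ℝ, F)) 𝓘(ℝ, ℝ) q e := fun e ↦
    (contMDiff_quadratic G e).mdifferentiableAt (by simp)
  have h1 : mfderiv 𝓘(ℝ, V) 𝓘(ℝ, ℝ) (A.pairing G v v) x =
      (mfderiv (𝓘(ℝ, V).prod 𝓘(ℝ, F)) 𝓘(ℝ, ℝ) q ⟨x, v x⟩).comp
        (mfderiv 𝓘(ℝ, V) (𝓘(ℝ, V).prod 𝓘(ℝ, F)) (fun y ↦ (⟨y, v y⟩ : TotalSpace F E)) x) :=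
    mfderiv_comp (g := q) x (hqd ⟨x, v x⟩) ((v.contMDiff x).mdifferentiableAt (by simp))
  have h2 : mfderiv (𝓘(ℝ, V).prod 𝓘(ℝ, F)) 𝓘(ℝ, ℝ) q ⟨x, v x⟩
      (verticalLift (V := V) (F := F) (v x) (⁅u, v⁆ x)) = (2 * A.pairing G ⁅u, v⁆ v x : ℝ) := by
    set w := ⁅u, v⁆ x with hw
    have hc := ((by simpa using hqd ⟨x, v x⟩ : MDifferentiableAt (𝓘(ℝ, V).prod 𝓘(ℝ, F)) 𝓘(ℝ, ℝ) q
      ⟨x, v x + (0 : ℝ) • w⟩)).hasMFDerivAt.comp (0 : ℝ)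
      (mdifferentiable_fibreLine (V := V) (F := F) (v x) w).hasMFDerivAt
    have hd : HasDerivAt (fun t : ℝ ↦ G.inner x (v x + t • w) (v x + t • w))
        (2 * G.inner x w (v x)) 0 := by
      have : (fun t : ℝ ↦ G.inner x (v x + t • w) (v x + t • w)) = fun t : ℝ ↦
          G.inner x (v x) (v x) + t * (2 * G.inner x w (v x)) + t ^ 2 * G.inner x w w := by
        ext t
        have h := G.symm x (v x) w
        simp only [map_add, map_smul, _root_.add_apply, _root_.smul_apply, smul_eq_mul, h]
        ring
      rw [this]
      have := (((hasDerivAt_id (0 : ℝ)).mul_const (2 * G.inner x w (v x))).const_add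
        (G.inner x (v x) (v x))).add (((hasDerivAt_id (0 : ℝ)).pow 2).mul_const (G.inner x w w))
      refine HasDerivAt.congr_deriv this (by simp)
    have h3 := hasMFDerivAt_unique hc hd.hasFDerivAt.hasMFDerivAt
    have h4 := congrArg (fun L : ℝ →L[ℝ] ℝ ↦ L 1) h3
    -- The chain rule is based at `v x + 0 • w`, which equals `v x` only propositionally; this moves
    -- the derivative between the two tangent spaces.
    have h5 : ∀ e' : E x, e' = v x + (0 : ℝ) • w →
        (mfderiv (𝓘(ℝ, V).prod 𝓘(ℝ, F)) 𝓘(ℝ, ℝ) q ⟨x, e'⟩ : V × F →L[ℝ] ℝ) =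
        mfderiv (𝓘(ℝ, V).prod 𝓘(ℝ, F)) 𝓘(ℝ, ℝ) q ⟨x, v x + (0 : ℝ) • w⟩ := by
      rintro _ rfl; rfl
    have h6 := h5 (v x) (by simp)
    refine (congrArg (fun L : V × F →L[ℝ] ℝ ↦
      L (verticalLift (V := V) (F := F) (v x) w)) h6).trans (h4.trans ?_)
    exact one_mul _
  refine (map_sub (mfderiv (𝓘(ℝ, V).prod 𝓘(ℝ, F)) 𝓘(ℝ, ℝ) q ⟨x, v x⟩) _ _).trans ?_
  refine congrArg₂ (fun a b : ℝ ↦ a - b) ?_ h2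
  exact (congrArg (fun L : V →L[ℝ] ℝ ↦ L (A.anchor x (u x))) h1).symm

theorem isKilling_iff (u : A.Sections) :
    A.IsKilling G u ↔ ∀ v : A.Sections, A.act u (A.pairing G v v) = (2 : ℝ) • A.pairing G ⁅u, v⁆ v := by
  constructor
  · intro h v
    refine ContMDiffMap.ext fun x ↦ ?_
    have h1 := A.mfderiv_quadratic_tangentLift G u v x
    exact sub_eq_zero.1 (h1.symm.trans (h ⟨x, v x⟩))
  · intro h e
    obtain ⟨v, hv⟩ := A.exists_section e
    rw [← hv]
    refine (A.mfderiv_quadratic_tangentLift G u v e.proj).trans ?_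
    exact sub_eq_zero.2 (congrArg (fun f : C^∞⟮𝓘(ℝ, V), M; ℝ⟯ ↦ f e.proj) (h v))

variable {G A} in
-- Polarisation of `isKilling_iff`.
theorem IsKilling.act_pairing {u : A.Sections} (h : A.IsKilling G u) (v w : A.Sections) :
    A.act u (A.pairing G v w) = A.pairing G ⁅u, v⁆ w + A.pairing G v ⁅u, w⁆ := by
  rw [isKilling_iff] at h
  have h1 := h (v + w)
  simp only [map_add, LinearMap.add_apply, lie_add, h v, h w, A.pairing_comm G w v,
    A.pairing_comm G v ⁅u, w⁆] at h1 ⊢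
  refine ContMDiffMap.ext fun x ↦ ?_
  have h2 := congrArg (fun f : C^∞⟮𝓘(ℝ, V), M; ℝ⟯ ↦ f x) h1
  have h2' : 2 * A.pairing G ⁅u, v⁆ v x + A.act u (A.pairing G v w) x
      + (A.act u (A.pairing G v w) x + 2 * A.pairing G ⁅u, w⁆ w x) =
    2 * (A.pairing G ⁅u, v⁆ v x + A.pairing G ⁅u, w⁆ v x
      + (A.pairing G ⁅u, v⁆ w x + A.pairing G ⁅u, w⁆ w x)) := h2
  change A.act u (A.pairing G v w) x = A.pairing G ⁅u, v⁆ w x + A.pairing G ⁅u, w⁆ v x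
  linarith

variable {G A} in
theorem IsKilling.lie {u v : A.Sections} (hu : A.IsKilling G u) (hv : A.IsKilling G v) :
    A.IsKilling G ⁅u, v⁆ := by
  rw [isKilling_iff]
  intro w
  rw [act_lie, hu.act_pairing, hv.act_pairing]
  simp only [map_add, hu.act_pairing, hv.act_pairing]
  have h := congrArg (fun z ↦ A.pairing G z w) (leibniz_lie u v w)
  simp only [map_add, LinearMap.add_apply] at h
  rw [A.pairing_comm G w ⁅u, ⁅v, w⁆⁆, A.pairing_comm G w ⁅v, ⁅u, w⁆⁆,
    A.pairing_comm G ⁅u, w⁆ ⁅v, w⁆, h, two_smul]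
  ring

/-- The Killing sections form a Lie subalgebra. -/
def iso : LieSubalgebra ℝ A.Sections where
  carrier := {u | A.IsKilling G u}
  zero_mem' := (A.isKilling_iff G 0).2 fun v ↦ by simp
  add_mem' {u v} hu hv := (A.isKilling_iff G (u + v)).2 fun w ↦ by
    rw [add_lie, map_add, map_add, LinearMap.add_apply, smul_add,
      ← (A.isKilling_iff G u).1 hu, ← (A.isKilling_iff G v).1 hv]
    rfl
  smul_mem' c u hu := (A.isKilling_iff G (c • u)).2 fun w ↦ ContMDiffMap.ext fun x ↦ by
    have h := congrArg (fun f : C^∞⟮𝓘(ℝ, V), M; ℝ⟯ ↦ c * f x) ((A.isKilling_iff G u).1 hu w)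
    have h1 : A.act (c • u) (A.pairing G w w) x = c * A.act u (A.pairing G w w) x := by
      rw [act_apply, Sections.real_smul_apply, map_smul]
      exact map_smul (mfderiv 𝓘(ℝ, V) 𝓘(ℝ, ℝ) _ x) _ _
    have h2 : A.pairing G ⁅c • u, w⁆ w x = c * A.pairing G ⁅u, w⁆ w x := by
      rw [smul_lie, pairing_apply, Sections.real_smul_apply, map_smul]; rfl
    change _ = 2 * A.pairing G ⁅c • u, w⁆ w x
    rw [h1, h2]
    exact h.trans (by change c * (2 * A.pairing G ⁅u, w⁆ w x) = _; ring)
  lie_mem' hu hv := IsKilling.lie hu hv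

theorem mem_iso (u : A.Sections) : u ∈ A.iso G ↔ A.IsKilling G u := Iff.rfl

end Killing

/-! ### Local frames made of global sections. -/

section Frame

/-- Global sections forming a local frame of `E` near `x₀`, with the cut-off function `χ` through
which arbitrary sections are expanded. -/
structure Frame (A : LieAlgebroid V F E) (x₀ : M) where
  /-- the sections of the frame -/
  sec : Fin (Module.finrank ℝ F) → A.Sections
  /-- the cut-off function -/
  cutoff : C^∞⟮𝓘(ℝ, V), M; ℝ⟯
  cutoff_eq_one : ∀ᶠ y in 𝓝 x₀, cutoff y = 1
  exists_expansion : ∀ w : A.Sections, ∃ c : Fin (Module.finrank ℝ F) → C^∞⟮𝓘(ℝ, V), M; ℝ⟯,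
    cutoff • w = ∑ i, c i • sec i
  /-- the coordinates of a point of the total space in the frame -/
  coord : Fin (Module.finrank ℝ F) → TotalSpace F E → ℝ
  continuousAt_coord : ∀ i e, e.proj = x₀ → ContinuousAt (coord i) e
  sum_coord : ∀ᶠ y in 𝓝 x₀, ∀ e : E y, ∑ i, coord i ⟨y, e⟩ • sec i y = e
  linearIndependent : LinearIndependent ℝ (fun i ↦ sec i x₀)

variable [ContMDiffVectorBundle ∞ F E 𝓘(ℝ, V)] [FiniteDimensional ℝ V] [T2Space M]
  [FiniteDimensional ℝ F] (A : LieAlgebroid V F E)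

theorem nonempty_frame (x : M) : Nonempty (A.Frame x) := by
  set t := trivializationAt F E x with ht
  have hx : x ∈ t.baseSet := FiberBundle.mem_baseSet_trivializationAt' x
  obtain ⟨φ, hφ, h1⟩ := exists_bump (V := V) x (t.open_baseSet.mem_nhds hx)
  let b := Module.finBasis ℝ F
  let S : Fin (Module.finrank ℝ F) → A.Sections := fun i ↦
    (⟨_, ContMDiffOn.smul_section_of_tsupport (ψ := φ) φ.contMDiff.contMDiffOn
      t.open_baseSet hφ (t.contMDiffOn_localFrame_baseSet (I := 𝓘(ℝ, V)) ∞ b i)⟩ :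
        Cₛ^∞⟮𝓘(ℝ, V); F, E⟯)
  have hS : ∀ i y, S i y = φ y • t.localFrame b i y := fun i y ↦ rfl
  have hsum : ∀ y ∈ t.baseSet, ∀ e : E y,
      ∑ i, b.repr (t ⟨y, e⟩).2 i • t.localFrame b i y = e := by
    intro y hy e
    conv_rhs => rw [← (t.basisAt b hy).sum_repr e]
    refine Finset.sum_congr rfl fun i _ ↦ ?_
    rw [t.localFrame_apply_of_mem_baseSet b hy]
    simp [Trivialization.basisAt]
  have hf : ∀ (w : A.Sections) i, ContMDiff 𝓘(ℝ, V) 𝓘(ℝ, ℝ) ∞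
      (fun y ↦ φ y • (b.coord i).toContinuousLinearMap (t ⟨y, w y⟩).2) := by
    intro w i
    have hZ : ContMDiffOn 𝓘(ℝ, V) 𝓘(ℝ, F) ∞ (fun y ↦ (t ⟨y, w y⟩).2) t.baseSet :=
      t.contMDiffOn_section_baseSet_iff.1 w.contMDiff.contMDiffOn
    refine contMDiff_of_tsupport fun y hy ↦ ?_
    have hy' : y ∈ t.baseSet := hφ (tsupport_smul_subset_left _ _ hy)
    exact (φ.contMDiff y).smul ((ContinuousLinearMap.contMDiff _).contMDiffAt.comp y
      (hZ.contMDiffAt (t.open_baseSet.mem_nhds hy')))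
  -- The cut-off is squared: one factor `φ` makes the coefficients globally smooth, the other does
  -- the same for the frame sections.
  refine ⟨⟨S, φ * φ, ?_, fun w ↦ ⟨fun i ↦ ⟨_, hf w i⟩, ?_⟩,
    fun i e ↦ (b.coord i).toContinuousLinearMap (t e).2, ?_, ?_, ?_⟩⟩
  · filter_upwards [h1] with y hy
    change φ y * φ y = 1
    rw [hy, one_mul]
  · refine Sections.ext A fun y ↦ ?_
    rw [Sections.sum_apply]
    change (φ y * φ y) • w y = ∑ i, (φ y • b.repr (t ⟨y, w y⟩).2 i) • (φ y • t.localFrame b i y)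
    by_cases hy : y ∈ t.baseSet
    · conv_lhs => rw [← hsum y hy (w y)]
      rw [Finset.smul_sum]
      refine Finset.sum_congr rfl fun i _ ↦ ?_
      simp only [smul_smul, smul_eq_mul]
      ring_nf
    · have : φ y = 0 := image_eq_zero_of_notMem_tsupport fun h' ↦ hy (hφ h')
      simp [this]
  · rintro i e rfl
    have he : e ∈ t.source := t.mem_source.2 hx
    exact (ContinuousLinearMap.continuous _).continuousAt.comp
      (continuous_snd.continuousAt.comp (t.continuousAt he))
  · filter_upwards [t.open_baseSet.mem_nhds hx, h1] with y hy hy1 e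
    refine Eq.trans (Finset.sum_congr rfl fun i _ ↦ ?_) (hsum y hy e)
    rw [hS, hy1, one_smul]
    rfl
  · have : (fun i ↦ S i x) = t.basisAt b hx := by
      funext i
      rw [hS, h1.self_of_nhds, one_smul, t.localFrame_apply_of_mem_baseSet b hx]
    rw [this]
    exact (t.basisAt b hx).linearIndependent

end Frame

/-! ### Tensorial expressions are bounded by frame components. -/

section Estimates

open Asymptotics

theorem _root_.Asymptotics.IsBigO.tendsto_mul {X W : Type*} [NormedAddCommGroup W]
    {l : Filter X} {g h : X → ℝ} {c : ℝ} {N : X → W} (hh : h =O[l] N)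
    (hg : Filter.Tendsto g l (𝓝 c)) : (fun y ↦ g y * h y) =O[l] N := by
  have h1 := (hg.isBigO_one ℝ).mul hh.norm_right
  simp only [one_mul] at h1
  exact h1.of_norm_right

variable [ContMDiffVectorBundle ∞ F E 𝓘(ℝ, V)] {A : LieAlgebroid V F E}
  [∀ x, IsTopologicalAddGroup (E x)] [∀ x, ContinuousConstSMul ℝ (E x)]
  (G : ContMDiffRiemannianMetric 𝓘(ℝ, V) ∞ F E) {x₀ : M} (fr : A.Frame x₀)

/-- The components of a section with respect to a frame, as inner products. -/
def Frame.comp (w : A.Sections) (y : M) : Fin (Module.finrank ℝ F) → ℝ :=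
  fun j ↦ A.pairing G w (fr.sec j) y

/-- The Gram matrix of a frame. -/
def Frame.gram (y : M) : Matrix (Fin (Module.finrank ℝ F)) (Fin (Module.finrank ℝ F)) ℝ :=
  fun i j ↦ A.pairing G (fr.sec i) (fr.sec j) y

theorem Frame.continuous_gram : Continuous (fr.gram G) :=
  continuous_pi fun i ↦ continuous_pi fun j ↦
    (A.pairing G (fr.sec i) (fr.sec j)).contMDiff.continuous

theorem Frame.det_gram_ne_zero : (fr.gram G x₀).det ≠ 0 := by
  intro h
  obtain ⟨c, hc, h0⟩ := Matrix.exists_mulVec_eq_zero_iff.2 h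
  apply hc
  set e := ∑ i, c i • fr.sec i x₀ with he
  have h1 : G.inner x₀ e e = 0 := by
    conv_lhs => rw [he]
    simp only [map_sum, map_smul, _root_.sum_apply, _root_.smul_apply, smul_eq_mul]
    refine Finset.sum_eq_zero fun i _ ↦ ?_
    have := congrFun h0 i
    simp only [Matrix.mulVec, dotProduct, Pi.zero_apply] at this
    refine mul_eq_zero_of_right _ (Eq.trans (Finset.sum_congr rfl fun j _ ↦ ?_) this)
    rw [mul_comm, G.symm]; rfl
  have h2 : e = 0 := by
    by_contra hne
    exact (G.pos x₀ e hne).ne' h1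
  funext i
  exact Fintype.linearIndependent_iff.1 fr.linearIndependent c h2 i

theorem Frame.isBigO_pairing_sec (w : A.Sections) (j : Fin (Module.finrank ℝ F)) (l : Filter M) :
    (A.pairing G w (fr.sec j) : M → ℝ) =O[l] fr.comp G w :=
  isBigO_of_le _ fun y ↦ norm_le_pi_norm (fr.comp G w y) j

/-- Near `x₀` the components are the coefficients times the Gram matrix. That matrix is continuous
and invertible at `x₀`, so Cramer's rule recovers the coefficients with locally bounded factors. -/
theorem Frame.isBigO_expansion {w : A.Sections}
    {c : Fin (Module.finrank ℝ F) → C^∞⟮𝓘(ℝ, V), M; ℝ⟯}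
    (hc : fr.cutoff • w = ∑ i, c i • fr.sec i) (i : Fin (Module.finrank ℝ F)) :
    (c i : M → ℝ) =O[𝓝 x₀] fr.comp G w := by
  have hdet : ContinuousAt (fun y ↦ ((fr.gram G y).det)⁻¹) x₀ :=
    (fr.continuous_gram G).matrix_det.continuousAt.inv₀ (fr.det_gram_ne_zero G)
  have hadj : ∀ j, ContinuousAt (fun y ↦ (fr.gram G y).adjugate j i) x₀ := fun j ↦
    ((continuous_apply i).comp ((continuous_apply j).comp
      (fr.continuous_gram G).matrix_adjugate)).continuousAt
  have h : (fun y ↦ ∑ j, (((fr.gram G y).det)⁻¹ * (fr.gram G y).adjugate j i) *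
      A.pairing G w (fr.sec j) y) =O[𝓝 x₀] fr.comp G w :=
    IsBigO.fun_sum fun j _ ↦ (fr.isBigO_pairing_sec G w j _).tendsto_mul
      (hdet.mul (hadj j))
  refine h.congr' ?_ Filter.EventuallyEq.rfl
  filter_upwards [fr.cutoff_eq_one, (fr.continuous_gram G).matrix_det.continuousAt.eventually_ne
    (fr.det_gram_ne_zero G)] with y hy hd
  have h1 : fr.comp G w y = Matrix.vecMul (fun i ↦ c i y) (fr.gram G y) := by
    funext j
    have h2 : w y = ∑ i, c i y • fr.sec i y := by
      have := congrArg (fun z : A.Sections ↦ z y) hc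
      rw [← one_smul ℝ (w y), ← hy]
      refine this.trans ?_
      rw [Sections.sum_apply]
      rfl
    rw [Frame.comp, pairing_apply, h2]
    simp only [map_sum, map_smul, _root_.sum_apply, _root_.smul_apply, smul_eq_mul]
    rfl
  have h3 := congrArg (fun z ↦ Matrix.vecMul z (fr.gram G y).adjugate i) h1
  simp only [Matrix.vecMul_vecMul, Matrix.mul_adjugate] at h3
  rw [Matrix.vecMul_smul, Matrix.vecMul_one] at h3
  have h4 : ∑ j, fr.comp G w y j * (fr.gram G y).adjugate j i = (fr.gram G y).det * c i y := h3
  calc _ = ((fr.gram G y).det)⁻¹ * ∑ j, fr.comp G w y j * (fr.gram G y).adjugate j i := by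
        rw [Finset.mul_sum]
        refine Finset.sum_congr rfl fun j _ ↦ ?_
        rw [Frame.comp]; ring
    _ = c i y := by rw [h4, inv_mul_cancel_left₀ hd]

/-- A tensorial expression in a section is locally bounded by the components of the section. -/
theorem Frame.isBigO_tensorial
    (Φ : A.Sections →ₗ[C^∞⟮𝓘(ℝ, V), M; ℝ⟯] C^∞⟮𝓘(ℝ, V), M; ℝ⟯) (w : A.Sections) :
    (Φ w : M → ℝ) =O[𝓝 x₀] fr.comp G w := by
  obtain ⟨c, hc⟩ := fr.exists_expansion w
  have h : (fun y ↦ ∑ i, Φ (fr.sec i) y * c i y) =O[𝓝 x₀] fr.comp G w :=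
    IsBigO.fun_sum fun i _ ↦ (fr.isBigO_expansion G hc i).tendsto_mul
      (Φ (fr.sec i)).contMDiff.continuous.continuousAt
  refine h.congr' ?_ Filter.EventuallyEq.rfl
  filter_upwards [fr.cutoff_eq_one] with y hy
  have h1 := congrArg (fun z ↦ Φ z y) hc
  simp only [map_sum, map_smul] at h1
  have h2 : fr.cutoff y * Φ w y = ∑ i, c i y * Φ (fr.sec i) y := by
    refine Eq.trans h1 ?_
    exact map_sum (ContMDiffMap.evalRingHom (n := ∞) y) _ _
  rw [hy, one_mul] at h2
  rw [h2]
  exact Finset.sum_congr rfl fun i _ ↦ mul_comm _ _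

theorem Frame.isBigO_act (w : A.Sections) (f : C^∞⟮𝓘(ℝ, V), M; ℝ⟯) :
    (A.act w f : M → ℝ) =O[𝓝 x₀] fr.comp G w :=
  fr.isBigO_tensorial G
    { toFun := fun w ↦ A.act w f
      map_add' := fun u v ↦ by rw [map_add]; rfl
      map_smul' := fun g u ↦ by rw [map_smul]; rfl } w

theorem Frame.isBigO_pairing (w s : A.Sections) :
    (A.pairing G w s : M → ℝ) =O[𝓝 x₀] fr.comp G w :=
  fr.isBigO_tensorial G ((A.pairing G).flip s) w

/-- Along `v`, the derivative of `⟨w | s⟩` differs from `⟨[v, w] | s⟩` by a term of order zero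
in `w`. -/
theorem Frame.isBigO_act_pairing_sub (v w s : A.Sections) :
    (A.act v (A.pairing G w s) - A.pairing G ⁅v, w⁆ s : C^∞⟮𝓘(ℝ, V), M; ℝ⟯) =O[𝓝 x₀]
      fr.comp G w :=
  fr.isBigO_tensorial G
    { toFun := fun w ↦ A.act v (A.pairing G w s) - A.pairing G ⁅v, w⁆ s
      map_add' := fun u w ↦ by
        simp only [map_add, LinearMap.add_apply, lie_add]
        abel
      map_smul' := fun f w ↦ by
        simp only [map_smul, map_add, LinearMap.add_apply, LinearMap.smul_apply, lie_fun_smul,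
          smul_eq_mul, Derivation.leibniz, RingHom.id_apply]
        ring } w

end Estimates

/-! ### Prolongation of the Killing equation. -/

section Prolongation

open Asymptotics

variable [ContMDiffVectorBundle ∞ F E 𝓘(ℝ, V)] {A : LieAlgebroid V F E}
  [∀ x, IsTopologicalAddGroup (E x)] [∀ x, ContinuousConstSMul ℝ (E x)]
  (G : ContMDiffRiemannianMetric 𝓘(ℝ, V) ∞ F E) {x₀ : M} (fr : A.Frame x₀) (u : A.Sections)

/-- The components of a section `u` and of its brackets with the sections of a frame. -/
def Frame.jet (y : M) : (Fin (Module.finrank ℝ F) → ℝ) ×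
    (Fin (Module.finrank ℝ F) → Fin (Module.finrank ℝ F) → ℝ) :=
  (fr.comp G u y, fun i ↦ fr.comp G ⁅u, fr.sec i⁆ y)

/-- The functions locally bounded by the jet of `u` in a frame. -/
def Frame.lower : Submodule C^∞⟮𝓘(ℝ, V), M; ℝ⟯ C^∞⟮𝓘(ℝ, V), M; ℝ⟯ where
  carrier := {f | (f : M → ℝ) =O[𝓝 x₀] fr.jet G u}
  zero_mem' := isBigO_zero _ _
  add_mem' hf hg := IsBigO.add hf hg
  smul_mem' g _ hf := IsBigO.tendsto_mul hf g.contMDiff.continuous.continuousAt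

theorem Frame.mem_lower {f : C^∞⟮𝓘(ℝ, V), M; ℝ⟯} :
    f ∈ fr.lower G u ↔ (f : M → ℝ) =O[𝓝 x₀] fr.jet G u := Iff.rfl

theorem Frame.mem_lower_of_cutoff_mul {f : C^∞⟮𝓘(ℝ, V), M; ℝ⟯}
    (h : fr.cutoff * f ∈ fr.lower G u) : f ∈ fr.lower G u := by
  refine ((fr.mem_lower G u).1 h).congr' ?_ Filter.EventuallyEq.rfl
  filter_upwards [fr.cutoff_eq_one] with y hy
  change fr.cutoff y * f y = f y
  rw [hy, one_mul]

theorem Frame.isBigO_comp : fr.comp G u =O[𝓝 x₀] fr.jet G u :=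
  isBigO_of_le _ fun _ ↦ le_max_left _ _

theorem Frame.isBigO_comp_lie_sec (i : Fin (Module.finrank ℝ F)) :
    fr.comp G ⁅u, fr.sec i⁆ =O[𝓝 x₀] fr.jet G u :=
  isBigO_of_le _ fun y ↦ (norm_le_pi_norm (fr.jet G u y).2 i).trans (le_max_right _ _)

theorem Frame.act_mem_lower (f : C^∞⟮𝓘(ℝ, V), M; ℝ⟯) : A.act u f ∈ fr.lower G u :=
  (fr.isBigO_act G u f).trans (fr.isBigO_comp G u)

/-- Brackets with the frame suffice, since [u, c s_i] = c [u, s_i] + ρ(u)[c] s_i and the last term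
is of order zero in u. -/
theorem Frame.pairing_lie_mem_lower (v s : A.Sections) :
    A.pairing G ⁅u, v⁆ s ∈ fr.lower G u := by
  obtain ⟨c, hc⟩ := fr.exists_expansion v
  have h := congrArg (fun z ↦ A.pairing G ⁅u, z⁆ s) hc
  simp only [lie_fun_smul, lie_sum, map_add, map_sum, map_smul, LinearMap.add_apply,
    LinearMap.smul_apply, LinearMap.sum_apply, smul_eq_mul] at h
  refine fr.mem_lower_of_cutoff_mul G u ?_
  rw [eq_sub_of_add_eq h]
  refine Submodule.sub_mem _ (Submodule.sum_mem _ fun i _ ↦ Submodule.add_mem _ ?_ ?_) ?_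
  · exact Submodule.smul_mem _ _
      ((fr.isBigO_pairing G ⁅u, fr.sec i⁆ s).trans (fr.isBigO_comp_lie_sec G u i))
  · rw [mul_comm]
    exact Submodule.smul_mem _ _ (fr.act_mem_lower G u _)
  · rw [mul_comm]
    exact Submodule.smul_mem _ _ (fr.act_mem_lower G u _)

theorem Frame.isBigO_comp_lie (v : A.Sections) : fr.comp G ⁅u, v⁆ =O[𝓝 x₀] fr.jet G u :=
  isBigO_pi.2 fun j ↦ fr.pairing_lie_mem_lower G u v (fr.sec j)

theorem Frame.act_lie_mem_lower (v : A.Sections) (f : C^∞⟮𝓘(ℝ, V), M; ℝ⟯) :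
    A.act ⁅u, v⁆ f ∈ fr.lower G u :=
  (fr.isBigO_act G ⁅u, v⁆ f).trans (fr.isBigO_comp_lie G u v)

theorem Frame.act_pairing_mem_lower (v s : A.Sections) :
    A.act v (A.pairing G u s) ∈ fr.lower G u := by
  have h : A.act v (A.pairing G u s) - A.pairing G ⁅v, u⁆ s ∈ fr.lower G u :=
    (fr.isBigO_act_pairing_sub G v u s).trans (fr.isBigO_comp G u)
  rw [← lie_skew, map_neg, LinearMap.neg_apply, sub_neg_eq_add] at h
  exact (Submodule.add_mem_iff_left _ (fr.pairing_lie_mem_lower G u v s)).1 h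

/-- Up to lower terms ρ(a)⟨[u,b]|c⟩ is ⟨[a,[u,b]]|c⟩. By Jacobi, exchanging a and b changes this by
⟨[u,[a,b]]|c⟩, which contains only one bracket with u and so is lower. -/
theorem Frame.act_pairing_lie_symm (a b c : A.Sections) :
    A.act a (A.pairing G ⁅u, b⁆ c) - A.act b (A.pairing G ⁅u, a⁆ c) ∈ fr.lower G u := by
  have h1 : A.act a (A.pairing G ⁅u, b⁆ c) - A.pairing G ⁅a, ⁅u, b⁆⁆ c ∈ fr.lower G u :=
    (fr.isBigO_act_pairing_sub G a ⁅u, b⁆ c).trans (fr.isBigO_comp_lie G u b)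
  have h2 : A.act b (A.pairing G ⁅u, a⁆ c) - A.pairing G ⁅b, ⁅u, a⁆⁆ c ∈ fr.lower G u :=
    (fr.isBigO_act_pairing_sub G b ⁅u, a⁆ c).trans (fr.isBigO_comp_lie G u a)
  have h3 := fr.pairing_lie_mem_lower G u ⁅a, b⁆ c
  rw [leibniz_lie, ← lie_skew ⁅u, a⁆ b, map_add, map_neg, LinearMap.add_apply,
    LinearMap.neg_apply] at h3
  convert Submodule.add_mem _ (Submodule.sub_mem _ h1 h2) h3 using 1
  abel

variable [FiniteDimensional ℝ V] [T2Space M]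

/-- By `act_lie`, ρ(v)ρ(u)f = ρ(u)(ρ(v)f) - ρ([u,v])f, and neither term on the right differentiates
the jet. -/
theorem Frame.act_act_mem_lower (v : A.Sections) (f : C^∞⟮𝓘(ℝ, V), M; ℝ⟯) :
    A.act v (A.act u f) ∈ fr.lower G u := by
  have h := fr.act_lie_mem_lower G u v f
  rw [act_lie] at h
  exact (Submodule.sub_mem_iff_right _ (fr.act_mem_lower G u (A.act v f))).1 h

variable [FiniteDimensional ℝ F] {G u}

/-- The Killing equation, prolonged: the first derivatives of `⟨[u, b] | c⟩` are of order zero in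
the jet of `u`. -/
theorem Frame.act_pairing_lie_mem_lower (hu : A.IsKilling G u) (a b c : A.Sections) :
    A.act a (A.pairing G ⁅u, b⁆ c) ∈ fr.lower G u := by
  have skew : ∀ a b c : A.Sections,
      A.act a (A.pairing G ⁅u, b⁆ c) + A.act a (A.pairing G ⁅u, c⁆ b) ∈ fr.lower G u := by
    intro a b c
    rw [← map_add, A.pairing_comm G ⁅u, c⁆ b, ← hu.act_pairing]
    exact fr.act_act_mem_lower G u a _
  have symm := fr.act_pairing_lie_symm G u
  -- Symmetry in the first two slots and skewness in the last two are applied alternately, three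
  -- times each. The sum telescopes to 2 T(a,b,c), whence the factor 1/2.
  have h := Submodule.add_mem _ (Submodule.add_mem _ (Submodule.sub_mem _ (Submodule.sub_mem _
    (Submodule.add_mem _ (symm a b c) (skew b a c)) (symm b c a)) (skew c b a)) (symm c a b))
      (skew a c b)
  have h2 := Submodule.smul_of_tower_mem _ (1 / 2 : ℝ) h
  convert h2 using 1
  module

end Prolongation

/-! ### Propagation of vanishing along admissible curves. -/

section Uniqueness

open Asymptotics Filter

/-- The section `u` and all its brackets with other sections vanish at `y`. -/
def JetVanishes {A : LieAlgebroid V F E} (u : A.Sections) (y : M) : Prop :=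
  u y = 0 ∧ ∀ v : A.Sections, ⁅u, v⁆ y = 0

variable [ContMDiffVectorBundle ∞ F E 𝓘(ℝ, V)] {A : LieAlgebroid V F E}
  [FiniteDimensional ℝ V] [T2Space M] [FiniteDimensional ℝ F]

/-- Where `v` vanishes, [u,v] is the derivative of `v` in the direction ρ(u), and that direction is
zero here. -/
theorem lie_apply_eq_zero {u v : A.Sections} {y : M} (hu : u y = 0) (hv : v y = 0) :
    ⁅u, v⁆ y = 0 := by
  have h := A.bracket_of_zero u v y hv
  have h0 : A.anchor y (u y) = 0 := by rw [hu, map_zero]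
  have hy : y ∈ (trivializationAt F E y).baseSet := FiberBundle.mem_baseSet_trivializationAt' y
  have h2 : (trivializationAt F E y).linearEquivAt ℝ y hy (⁅u, v⁆ y) = 0 :=
    h.trans ((congrArg (mfderiv 𝓘(ℝ, V) 𝓘(ℝ, F) _ y) h0).trans
      (map_zero (mfderiv 𝓘(ℝ, V) 𝓘(ℝ, F) _ y)))
  exact (LinearEquiv.map_eq_zero_iff _).1 h2

variable [∀ x, IsTopologicalAddGroup (E x)] [∀ x, ContinuousConstSMul ℝ (E x)]
  (G : ContMDiffRiemannianMetric 𝓘(ℝ, V) ∞ F E)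

theorem apply_eq_zero_iff (w : A.Sections) (y : M) : w y = 0 ↔ A.pairing G w w y = 0 := by
  rw [pairing_apply]
  refine ⟨fun h ↦ by rw [h, map_zero], fun h ↦ ?_⟩
  by_contra hne
  exact (G.pos y (w y) hne).ne' h

theorem isClosed_jetVanishes (G : ContMDiffRiemannianMetric 𝓘(ℝ, V) ∞ F E) (u : A.Sections) : IsClosed {y | JetVanishes u y} := by
  have h : ∀ w : A.Sections, IsClosed {y | w y = 0} := fun w ↦ by
    simp only [apply_eq_zero_iff G]
    exact isClosed_eq (A.pairing G w w).contMDiff.continuous continuous_const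
  simp only [JetVanishes, Set.ofPred_and, Set.ofPred_forall]
  exact (h u).inter (isClosed_iInter fun v ↦ h _)

theorem JetVanishes.jet_eq_zero {u : A.Sections} {y x₀ : M} (h : JetVanishes u y)
    (fr : A.Frame x₀) : fr.jet G u y = 0 := by
  refine Prod.ext (funext fun j ↦ ?_) (funext fun i ↦ funext fun j ↦ ?_)
  · change G.inner y (u y) _ = 0
    rw [h.1, map_zero]; rfl
  · change G.inner y (⁅u, fr.sec i⁆ y) _ = 0
    rw [h.2, map_zero]; rfl

theorem Frame.eventually_jetVanishes {x₀ : M} (fr : A.Frame x₀) :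
    ∀ᶠ y in 𝓝 x₀, ∀ u : A.Sections, fr.jet G u y = 0 → JetVanishes u y := by
  filter_upwards [fr.sum_coord] with y hy u hu
  have h0 : ∀ w : A.Sections, fr.comp G w y = 0 → w y = 0 := by
    intro w hw
    rw [apply_eq_zero_iff G, pairing_apply]
    conv_lhs => rw [← hy (w y), map_sum]
    refine Finset.sum_eq_zero fun j _ ↦ ?_
    rw [map_smul, hy (w y)]
    have : G.inner y (w y) (fr.sec j y) = 0 := congrFun hw j
    rw [this, smul_zero]
  have h1 : u y = 0 := h0 u (congrArg Prod.fst hu)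
  refine ⟨h1, fun v ↦ ?_⟩
  -- The coefficients are frozen at `y`, so they are real constants and pass through the bracket
  -- without a Leibniz term.
  have h2 : ⁅u, v - ∑ i, fr.coord i ⟨y, v y⟩ • fr.sec i⁆ y = 0 := by
    refine lie_apply_eq_zero h1 ?_
    rw [Sections.sub_apply, Sections.sum_apply]
    simp only [Sections.real_smul_apply]
    rw [hy, sub_self]
  rw [lie_sub, lie_sum, Sections.sub_apply, Sections.sum_apply, sub_eq_zero] at h2
  rw [h2]
  refine Finset.sum_eq_zero fun i _ ↦ ?_
  rw [lie_smul, Sections.real_smul_apply, h0 _ (congrFun (congrArg Prod.snd hu) i), smul_zero]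

/-- Along an admissible curve, the derivative of a function is bounded by the jet of `u` if its
derivatives along the frame are. -/
theorem Frame.isBigO_dirDeriv_curve {a : ℝ → TotalSpace F E} {S : Set ℝ} {t₀ : ℝ}
    (ha : ContinuousWithinAt a S t₀) (fr : A.Frame (a t₀).proj) (u : A.Sections)
    {f : C^∞⟮𝓘(ℝ, V), M; ℝ⟯} (hf : ∀ k, A.act (fr.sec k) f ∈ fr.lower G u) :
    (fun t ↦ dirDeriv f (a t).proj (A.anchor (a t).proj (a t).2)) =O[𝓝[S] t₀]
      (fun t ↦ fr.jet G u (a t).proj) := by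
  have hx : Tendsto (fun t ↦ (a t).proj) (𝓝[S] t₀) (𝓝 (a t₀).proj) :=
    ((FiberBundle.continuous_proj F E).tendsto _).comp ha
  have h : (fun t ↦ ∑ k, fr.coord k (a t) * A.act (fr.sec k) f (a t).proj) =O[𝓝[S] t₀]
      (fun t ↦ fr.jet G u (a t).proj) :=
    IsBigO.fun_sum fun k _ ↦ IsBigO.tendsto_mul (((fr.mem_lower G u).1 (hf k)).comp_tendsto hx)
      ((fr.continuousAt_coord k (a t₀) rfl).tendsto.comp ha)
  refine h.congr' ?_ EventuallyEq.rfl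
  filter_upwards [hx.eventually fr.sum_coord] with t ht
  conv_rhs => rw [← ht (a t).2]
  rw [map_sum]
  refine Eq.trans ?_ (map_sum (mfderiv 𝓘(ℝ, V) 𝓘(ℝ, ℝ) f (a t).proj) _ _).symm
  refine Finset.sum_congr rfl fun k _ ↦ ?_
  rw [map_smul]
  exact (map_smul (mfderiv 𝓘(ℝ, V) 𝓘(ℝ, ℝ) f (a t).proj) _ _).symm

variable {G}

/-- Frames are only local, so Grönwall is combined with continuation: the set of times at which the
jet vanishes is closed, contains 0, and extends to the right of each of its points below 1. -/
theorem IsKilling.jetVanishes_of_admissiblyJoined {u : A.Sections} (hu : A.IsKilling G u)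
    {p q : M} (hpq : A.AdmissiblyJoined p q) (hp : JetVanishes u p) : JetVanishes u q := by
  obtain ⟨a, ha, hder, rfl, rfl⟩ := hpq
  have hx : ContinuousOn (fun t ↦ (a t).proj) (Set.Icc 0 1) :=
    (FiberBundle.continuous_proj F E).comp_continuousOn ha.continuousOn
  have key : Set.Icc (0 : ℝ) 1 ⊆ {t | JetVanishes u (a t).proj} := by
    refine IsClosed.Icc_subset_of_forall_exists_gt ?_ hp ?_
    · rw [Set.inter_comm]
      exact hx.preimage_isClosed_of_isClosed isClosed_Icc (isClosed_jetVanishes G u)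
    rintro t₀ ⟨hz, ht₀⟩ y hy
    have ht₀' : t₀ ∈ Set.Icc (0 : ℝ) 1 := Set.Ico_subset_Icc_self ht₀
    obtain ⟨fr⟩ := A.nonempty_frame (a t₀).proj
    -- the derivative of the jet along the curve
    let D : C^∞⟮𝓘(ℝ, V), M; ℝ⟯ → ℝ → ℝ := fun f t ↦
      dirDeriv f (a t).proj (A.anchor (a t).proj (a t).2)
    have hD : ∀ (f : C^∞⟮𝓘(ℝ, V), M; ℝ⟯), ∀ t ∈ Set.Icc (0 : ℝ) 1,
        HasDerivWithinAt (fun t ↦ f (a t).proj) (D f t) (Set.Icc 0 1) t := by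
      intro f t ht
      have h := (f.mdifferentiableAt_real (a t).proj).hasMFDerivAt.comp_hasMFDerivWithinAt t
        (hder t ht)
      have h2 : HasFDerivWithinAt (fun t ↦ f (a t).proj)
          ((mfderiv 𝓘(ℝ, V) 𝓘(ℝ, ℝ) f (a t).proj : V →L[ℝ] ℝ).comp ((1 : ℝ →L[ℝ] ℝ).smulRight
            (A.anchor (a t).proj (a t).2 : V)) : ℝ →L[ℝ] ℝ) (Set.Icc 0 1) t := h.hasFDerivWithinAt
      refine hasDerivWithinAt_iff_hasFDerivWithinAt.2 (h2.congr_fderiv ?_)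
      refine ContinuousLinearMap.ext_ring ?_
      exact (congrArg (mfderiv 𝓘(ℝ, V) 𝓘(ℝ, ℝ) f (a t).proj) (one_smul ℝ _)).trans
        (one_smul ℝ (D f t)).symm
    have hO : (fun t ↦ ((fun j ↦ D (A.pairing G u (fr.sec j)) t,
        fun i j ↦ D (A.pairing G ⁅u, fr.sec i⁆ (fr.sec j)) t) :
          (Fin (Module.finrank ℝ F) → ℝ) ×
            (Fin (Module.finrank ℝ F) → Fin (Module.finrank ℝ F) → ℝ)))
          =O[𝓝[Set.Icc 0 1] t₀] (fun t ↦ fr.jet G u (a t).proj) := by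
      refine IsBigO.prod_left (isBigO_pi.2 fun j ↦ ?_)
        (isBigO_pi.2 fun i ↦ isBigO_pi.2 fun j ↦ ?_)
      · exact fr.isBigO_dirDeriv_curve G (ha.continuousOn t₀ ht₀') u fun k ↦
          fr.act_pairing_mem_lower G u _ _
      · exact fr.isBigO_dirDeriv_curve G (ha.continuousOn t₀ ht₀') u fun k ↦
          fr.act_pairing_lie_mem_lower hu _ _ _
    -- `C` depends on `u` and on `t₀`, which is harmless because both are fixed in this step.
    obtain ⟨C, hC⟩ := hO.bound
    have hle : 𝓝[≥] t₀ ≤ 𝓝[Set.Icc 0 1] t₀ := by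
      rw [← nhdsWithin_Icc_eq_nhdsGE ht₀.2]
      exact nhdsWithin_mono _ (Set.Icc_subset_Icc_left ht₀.1)
    have hev := (hC.filter_mono hle).and
      (((hx t₀ ht₀').eventually (fr.eventually_jetVanishes G)).filter_mono hle)
    obtain ⟨r, hr, hsub⟩ := mem_nhdsGE_iff_exists_Icc_subset.1 hev
    -- `r` bounds the interval where the estimate and the frame are valid, `y` is the limit imposed
    -- by the continuation principle, and 1 is the end of the curve.
    set b := min (min r y) 1 with hb
    have hbt : t₀ < b := lt_min (lt_min hr hy) ht₀.2
    have hb1 : b ≤ 1 := min_le_right _ _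
    have hbr : b ≤ r := (min_le_left _ _).trans (min_le_left _ _)
    have hby : b ≤ y := (min_le_left _ _).trans (min_le_right _ _)
    have hI : Set.Icc t₀ b ⊆ Set.Icc 0 1 := Set.Icc_subset_Icc ht₀.1 hb1
    have hjet : ∀ t ∈ Set.Icc (0 : ℝ) 1, HasDerivWithinAt (fun t ↦ fr.jet G u (a t).proj)
        (fun j ↦ D (A.pairing G u (fr.sec j)) t,
        fun i j ↦ D (A.pairing G ⁅u, fr.sec i⁆ (fr.sec j)) t) (Set.Icc 0 1) t := fun t ht ↦
      HasDerivWithinAt.prodMk (hasDerivWithinAt_pi.2 fun j ↦ hD _ t ht)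
        (hasDerivWithinAt_pi.2 fun i ↦ hasDerivWithinAt_pi.2 fun j ↦ hD _ t ht)
    have hzero := eq_zero_of_abs_deriv_le_mul_abs_self_of_eq_zero_right
      (f := fun t ↦ fr.jet G u (a t).proj) (K := C) (a := t₀) (b := b)
      (fun t ht ↦ ((hjet t (hI ht)).continuousWithinAt).mono hI)
      (fun t ht ↦ (hjet t (hI (Set.Ico_subset_Icc_self ht))).mono_of_mem_nhdsWithin (by
        rw [← nhdsWithin_Icc_eq_nhdsGE (ht.2.trans_le hb1)]
        exact mem_of_superset self_mem_nhdsWithin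
          (Set.Icc_subset_Icc_left (ht₀.1.trans ht.1))))
      (JetVanishes.jet_eq_zero G hz fr)
      (fun t ht ↦ (hsub ⟨ht.1, ht.2.le.trans hbr⟩).1)
    exact ⟨b, (hsub ⟨hbt.le, hbr⟩).2 u (hzero b ⟨hbt.le, le_rfl⟩), hbt, hby⟩
  exact key ⟨zero_le_one, le_rfl⟩

theorem IsKilling.eq_zero_of_jetVanishes {u : A.Sections} (hu : A.IsKilling G u)
    (hA : A.AdmissiblyConnected) {p : M} (hp : JetVanishes u p) : u = 0 := by
  refine Sections.ext A fun q ↦ ?_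
  have h : JetVanishes u q := by
    induction hA p q with
    | refl => exact hp
    | tail _ hbc ih => exact hu.jetVanishes_of_admissiblyJoined hbc ih
  exact h.1

end Uniqueness

/-! ### Counting parameters at one point. -/

section Dimension

variable [ContMDiffVectorBundle ∞ F E 𝓘(ℝ, V)] {A : LieAlgebroid V F E}
  [FiniteDimensional ℝ V] [T2Space M] [FiniteDimensional ℝ F]
  [∀ x, IsTopologicalAddGroup (E x)] [∀ x, ContinuousConstSMul ℝ (E x)]
  (G : ContMDiffRiemannianMetric 𝓘(ℝ, V) ∞ F E)

/-- The independent components of the jet of a Killing section at the centre of a frame. -/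
def Frame.killingData {x₀ : M} (fr : A.Frame x₀) : A.iso G →ₗ[ℝ]
    ({p : Fin (Module.finrank ℝ F) × Fin (Module.finrank ℝ F) // p.1 ≤ p.2} → ℝ) where
  -- A skew matrix needs only its entries with i < j, so the diagonal slots are free to hold the n
  -- components of u itself.
  toFun u p := if p.1.1 = p.1.2 then G.inner x₀ ((u : A.Sections) x₀) (fr.sec p.1.1 x₀)
    else G.inner x₀ (⁅(u : A.Sections), fr.sec p.1.1⁆ x₀) (fr.sec p.1.2 x₀)
  map_add' u v := by
    funext p
    simp only [show ((u + v : A.iso G) : A.Sections) = u + v from rfl, add_lie, Sections.add_apply, map_add, Pi.add_apply,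
      _root_.add_apply]
    split_ifs <;> rfl
  map_smul' c u := by
    funext p
    simp only [show ((c • u : A.iso G) : A.Sections) = c • (u : A.Sections) from rfl, smul_lie, Sections.real_smul_apply, map_smul,
      Pi.smul_apply, _root_.smul_apply, RingHom.id_apply]
    split_ifs <;> rfl

theorem Frame.killingData_injective {x₀ : M} (fr : A.Frame x₀) (hA : A.AdmissiblyConnected) :
    Function.Injective (fr.killingData G) := by
  refine (injective_iff_map_eq_zero _).2 fun u hu ↦ Subtype.ext ?_
  have hK : A.IsKilling G (u : A.Sections) := u.2
  have h1 : fr.comp G (u : A.Sections) x₀ = 0 := funext fun j ↦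
    (if_pos rfl).symm.trans (congrFun hu ⟨(j, j), le_rfl⟩)
  have h0 : (u : A.Sections) x₀ = 0 := by
    rw [apply_eq_zero_iff G, pairing_apply]
    conv_lhs => rw [← fr.sum_coord.self_of_nhds ((u : A.Sections) x₀), map_sum]
    refine Finset.sum_eq_zero fun j _ ↦ ?_
    rw [map_smul, fr.sum_coord.self_of_nhds]
    have : G.inner x₀ ((u : A.Sections) x₀) (fr.sec j x₀) = 0 := congrFun h1 j
    rw [this, smul_zero]
  have hlt : ∀ i j, i < j → A.pairing G ⁅(u : A.Sections), fr.sec i⁆ (fr.sec j) x₀ = 0 :=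
    fun i j hij ↦ (if_neg hij.ne).symm.trans (congrFun hu ⟨(i, j), hij.le⟩)
  -- Since `u` vanishes at `x₀`, so does the left side of `IsKilling.act_pairing`.
  have hskew : ∀ i j, A.pairing G ⁅(u : A.Sections), fr.sec i⁆ (fr.sec j) x₀ +
      A.pairing G ⁅(u : A.Sections), fr.sec j⁆ (fr.sec i) x₀ = 0 := by
    intro i j
    have h := congrArg (fun f : C^∞⟮𝓘(ℝ, V), M; ℝ⟯ ↦ f x₀) (hK.act_pairing (fr.sec i) (fr.sec j))
    rw [A.pairing_comm G (fr.sec i) ⁅(u : A.Sections), fr.sec j⁆] at h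
    refine h.symm.trans ?_
    rw [act_apply, h0, map_zero]
    exact map_zero (mfderiv 𝓘(ℝ, V) 𝓘(ℝ, ℝ) _ x₀)
  refine hK.eq_zero_of_jetVanishes hA ((fr.eventually_jetVanishes G).self_of_nhds u ?_)
  refine Prod.ext h1 (funext fun i ↦ funext fun j ↦ ?_)
  change A.pairing G ⁅(u : A.Sections), fr.sec i⁆ (fr.sec j) x₀ = 0
  rcases lt_trichotomy i j with h | rfl | h
  · exact hlt i j h
  · have := hskew i i
    linarith
  · have := hskew i j
    rwa [hlt j i h, add_zero] at this

theorem card_le_pairs (n : ℕ) :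
    Fintype.card {p : Fin n × Fin n // p.1 ≤ p.2} = n * (n + 1) / 2 := by
  rw [← Fintype.card_congr Sym2.sortEquiv, Sym2.card, Fintype.card_fin, Nat.choose_two_right,
    Nat.add_sub_cancel, mul_comm]

theorem finiteDimensional_iso (hA : A.AdmissiblyConnected) :
    FiniteDimensional ℝ (A.iso G) ∧
      Module.finrank ℝ (A.iso G) ≤ Module.finrank ℝ F * (Module.finrank ℝ F + 1) / 2 := by
  rcases isEmpty_or_nonempty M with hM | ⟨⟨x₀⟩⟩
  · have : Subsingleton (A.iso G) :=
      ⟨fun u v ↦ Subtype.ext (Sections.ext A fun x ↦ hM.elim x)⟩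
    exact ⟨inferInstance, by rw [Module.finrank_zero_of_subsingleton]; exact Nat.zero_le _⟩
  · obtain ⟨fr⟩ := A.nonempty_frame x₀
    have hinj := fr.killingData_injective G hA
    refine ⟨FiniteDimensional.of_injective _ hinj, ?_⟩
    refine (LinearMap.finrank_le_finrank_of_injective hinj).trans_eq ?_
    rw [Module.finrank_fintype_fun_eq_card, card_le_pairs]

end Dimension

end LieAlgebroid

end

theorem mainTheorem3
    {V : Type*} [NormedAddCommGroup V] [NormedSpace ℝ V] [FiniteDimensional ℝ V]
    {M : Type*} [TopologicalSpace M] [ChartedSpace V M] [IsManifold 𝓘(ℝ, V) ∞ M] [T2Space M]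
    {F : Type*} [NormedAddCommGroup F] [NormedSpace ℝ F] [FiniteDimensional ℝ F]
    {E : M → Type*} [TopologicalSpace (TotalSpace F E)]
    [∀ x, AddCommGroup (E x)] [∀ x, Module ℝ (E x)] [∀ x, TopologicalSpace (E x)]
    [∀ x, IsTopologicalAddGroup (E x)] [∀ x, ContinuousConstSMul ℝ (E x)]
    [FiberBundle F E] [VectorBundle ℝ F E] [ContMDiffVectorBundle ∞ F E 𝓘(ℝ, V)]
    (A : LieAlgebroid V F E) (G : ContMDiffRiemannianMetric 𝓘(ℝ, V) ∞ F E) :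
    ∃ iso : LieSubalgebra ℝ A.Sections,
      (∀ u : A.Sections, u ∈ iso ↔ A.IsKilling G u) ∧
      (A.AdmissiblyConnected →
        FiniteDimensional ℝ iso ∧
        Module.finrank ℝ iso ≤ Module.finrank ℝ F * (Module.finrank ℝ F + 1) / 2) :=
  ⟨A.iso G, A.mem_iso G, A.finiteDimensional_iso G⟩
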